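/- Let $q_1, q_2$ be prime numbers with $q_1\equiv q_2\equiv 3 \pmod 8$ and Legendre symbol $\left(\frac{q_1}{q_2}\right)=1$. Put $d=q_1q_2$ and $L_d=\mathbb{Q}(\zeta_8,\sqrt d)\subset\mathbb{C}$, where $\zeta_8=e^{2\pi i/8}$. For a number field $K$ let $E_K$ be the unit group of its ring of integers, and for a squarefree integer $m>1$ let $\varepsilon_m>1$ be the fundamental unit of $\mathbb{Q}(\sqrt m)\subset\mathbb{R}$, i.e. its smallest unit greater than $1$. Then $$E_{L_d}=\langle \zeta_8,\ \varepsilon_2,\ \varepsilon_{q_1q_2},\ \sqrt{\varepsilon_{2q_1q_2}}\rangle ,$$ and the unit index $q(L_d)=[E_{L_d}:\prod_i E_{k_i}]$, where $k_i$ runs over all quadratic subfields of $L_d$, is equal to $4$. -/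

import Mathlib

open NumberField IntermediateField

noncomputable section

/-- The unit group `E_K` of the ring of integers of a subfield `K` of `ℂ`,
regarded as a subgroup of `ℂˣ`. -/
def unitGroupIn (K : IntermediateField ℚ ℂ) : Subgroup ℂˣ :=
  (Units.map (((algebraMap K ℂ).comp (algebraMap (𝓞 K) K)) : 𝓞 K →* ℂ)).range

/-- The field `ℚ(√m)` inside `ℂ` (generated by the two square roots `±√m`). -/
def quadraticFieldIn (m : ℕ) : IntermediateField ℚ ℂ :=
  adjoin ℚ {z : ℂ | z ^ 2 = (m : ℂ)}

/-- The fundamental unit `ε_m` of the real quadratic field `ℚ(√m)` (`m > 1` squarefree):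
the smallest real number `> 1` that is a unit of the ring of integers of `ℚ(√m)`. -/
def fundamentalUnit (m : ℕ) : ℝ :=
  sInf {x : ℝ | 1 < x ∧ ∃ u ∈ unitGroupIn (quadraticFieldIn m), (u : ℂ) = (x : ℂ)}

/-- The primitive eighth root of unity `ζ₈ = exp(2πi/8)`. -/
def zetaEight : ℂ := Complex.exp (2 * Real.pi * Complex.I / 8)

/-- The field `L_d = ℚ(ζ₈, √d)` inside `ℂ`. -/
def fieldL (d : ℕ) : IntermediateField ℚ ℂ :=
  adjoin ℚ {zetaEight, ((Real.sqrt d : ℝ) : ℂ)}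

/-- The product of the unit groups of all quadratic subfields of `L`. -/
def quadraticUnits (L : IntermediateField ℚ ℂ) : Subgroup ℂˣ :=
  ⨆ (k : IntermediateField ℚ ℂ) (_ : k ≤ L ∧ Module.finrank ℚ k = 2), unitGroupIn k

/-- The unit index `q(L) = [E_L : ∏ᵢ E_{kᵢ}]`, where the `kᵢ` are the quadratic subfields of `L`
(with Mathlib's convention that an infinite index is `0`). -/
def unitIndex (L : IntermediateField ℚ ℂ) : ℕ :=
  (quadraticUnits L).relIndex (unitGroupIn L)

end

/-! Let d = q₁q₂ and K = ℚ(√2, √d), so that L_d = K(i). The proof finds the units of K, then lifts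
them to L_d.

Units of K. If x', x'' are the conjugates of x under √2 ↦ -√2 and √d ↦ -√d, then x² · (x'x'') =
(xx')(xx''), and each product is a unit of a quadratic field. Hence x² is, up to sign, a product of
powers of ε₂, ε_d, ε_{2d} (`sq_eq_of_unit`), and one must find which such products are squares in K.
Writing a unit of norm 1 as (2A+1) + 2z√m gives A(A+1) = mz², so its square root is v√b + u√a with
ab = m (`exists_sqrt_fundamentalUnit`). Congruences mod 8 and the non-residue -1 leave √ε_{2d} = u√2
+ v√d, which lies in K, and √ε_d = u√q₁ + v√q₂, which does not because √q₁ ∉ K. Since ε₂ has norm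
-1, both ε₂ and ε₂ε_d have a negative conjugate and are not squares. So ε₂, ε_d, √ε_{2d} generate
the positive units (`exists_zpow_of_unit`).

From K to L_d. For a unit u the quotient u/ū is a root of unity, hence a power of ζ₈. An even power
makes u a power of ζ₈ times a real unit. An odd power would produce a unit √2·r² with r ∈ K, which a
parity argument on its norm to ℚ(√d) forbids (`not_unit_sqrt_two_mul_sq`, `exists_pow_mul_real`).

Index. The quadratic subfields contribute ⟨i, ε₂, ε_d, ε_{2d}⟩; adjoining √ε_{2d} and then ζ₈
doubles the group each time. -/

/-! ### Squares and integrality over ℚ -/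

theorem Nat.Prime.not_isSquare_mul {p m : ℕ} (hp : p.Prime) (hm : ¬ p ∣ m) : ¬ IsSquare (p * m) := by
  rintro ⟨r, hr⟩
  have h1 : p ∣ r := by
    have : p ∣ r * r := ⟨m, hr.symm⟩
    exact (hp.dvd_mul.1 this).elim id id
  obtain ⟨k, rfl⟩ := h1
  apply hm
  have : p * m = p * (p * (k * k)) := by rw [hr]; ring
  exact ⟨k * k, Nat.eq_of_mul_eq_mul_left hp.pos this⟩

theorem rat_sq_ne_natCast {m : ℕ} (hm : ¬ IsSquare m) (q : ℚ) : q ^ 2 ≠ m := by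
  intro h
  apply hm
  rw [← Rat.isSquare_natCast_iff]
  exact ⟨q, by rw [← h, sq]⟩

theorem exists_int_of_isIntegral {q : ℚ} (h : IsIntegral ℤ (q : ℝ)) : ∃ n : ℤ, q = n := by
  have h1 : IsIntegral ℤ q := (isIntegral_algebraMap_iff (algebraMap ℚ ℝ).injective).1 h
  obtain ⟨n, hn⟩ := IsIntegrallyClosed.isIntegral_iff.1 h1
  exact ⟨n, by simpa using hn.symm⟩

/-- Pulling back along the injective `f` and pushing forward along `g` passes integrality from one
conjugate to another. -/
theorem IsIntegral.map_of_injective {A B C : Type*} [CommRing A] [CommRing B] [CommRing C]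
    (f : A →+* B) (g : A →+* C) (hf : Function.Injective f) {z : A} (h : IsIntegral ℤ (f z)) :
    IsIntegral ℤ (g z) := by
  have h1 : IsIntegral ℤ z := (isIntegral_algHom_iff f.toIntAlgHom hf).1 h
  exact h1.map g.toIntAlgHom

theorem rat_eq_one_or_neg_one {q r : ℚ} (hq : IsIntegral ℤ (q : ℝ)) (hr : IsIntegral ℤ (r : ℝ))
    (h : q * r = 1) : q = 1 ∨ q = -1 := by
  obtain ⟨n, rfl⟩ := exists_int_of_isIntegral hq
  obtain ⟨k, rfl⟩ := exists_int_of_isIntegral hr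
  have h' : n * k = 1 := by exact_mod_cast h
  rcases Int.isUnit_iff.1 (IsUnit.of_mul_eq_one _ h') with h | h <;> simp [h]

/-! ### Units of real quadratic fields -/

/-- Evaluation of `a + b ω` at a square root `s` of `m`. -/
noncomputable def quadraticEval (m : ℕ) (s : ℝ) (hs : s ^ 2 = m) :
    QuadraticAlgebra ℚ (m : ℚ) 0 →+* ℝ where
  toFun z := z.re + z.im * s
  map_zero' := by simp
  map_one' := by
    have h1 : (1 : QuadraticAlgebra ℚ (m : ℚ) 0).re = 1 := rfl
    have h2 : (1 : QuadraticAlgebra ℚ (m : ℚ) 0).im = 0 := rfl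
    simp [h1, h2]
  map_add' z w := by simp; ring
  map_mul' z w := by simp; linear_combination (-(z.im : ℝ) * w.im) * hs

theorem quadraticEval_apply (m : ℕ) (s : ℝ) (hs : s ^ 2 = m) (z : QuadraticAlgebra ℚ (m : ℚ) 0) :
    quadraticEval m s hs z = z.re + z.im * s := rfl

theorem eq_zero_of_add_mul_eq_zero {m : ℕ} (hm : ¬ IsSquare m) {s : ℝ} (hs : s ^ 2 = m) {a b : ℚ}
    (h : (a : ℝ) + b * s = 0) : a = 0 ∧ b = 0 := by
  have hb : b = 0 := by
    by_contra hb
    have hb' : (b : ℝ) ≠ 0 := by exact_mod_cast hb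
    apply rat_sq_ne_natCast hm (-a / b)
    have : s = -a / b := by field_simp; linarith
    rw [this] at hs
    exact_mod_cast hs
  subst hb
  simp at h
  exact ⟨h, rfl⟩

theorem quadraticEval_injective {m : ℕ} (hm : ¬ IsSquare m) {s : ℝ} (hs : s ^ 2 = m) :
    Function.Injective (quadraticEval m s hs) := by
  rw [injective_iff_map_eq_zero]
  intro z hz
  obtain ⟨h1, h2⟩ := eq_zero_of_add_mul_eq_zero hm hs hz
  exact QuadraticAlgebra.ext h1 h2

/-- The real number `x` lies in `ℚ(√m)` and is a unit of its ring of integers. -/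
def IsQuadraticUnit (m : ℕ) (x : ℝ) : Prop :=
  x ≠ 0 ∧ IsIntegral ℤ x ∧ IsIntegral ℤ x⁻¹ ∧ ∃ a b : ℚ, x = a + b * √m

theorem sq_sqrt_natCast (m : ℕ) : (√m : ℝ) ^ 2 = m := Real.sq_sqrt (Nat.cast_nonneg m)

theorem neg_sqrt_sq_natCast (m : ℕ) : (-√m : ℝ) ^ 2 = m := by rw [neg_sq, sq_sqrt_natCast]

theorem quadraticNorm_ne_zero {m : ℕ} (hm : ¬ IsSquare m) {a b : ℚ}
    (h : (a : ℝ) + b * √m ≠ 0) : a ^ 2 - m * b ^ 2 ≠ 0 := by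
  intro h0
  have hb : b = 0 := by
    by_contra hb
    apply rat_sq_ne_natCast hm (a / b)
    field_simp
    linarith
  subst hb
  have : a = 0 := by simpa using h0
  simp [this] at h

theorem inv_add_mul_sqrt {m : ℕ} (hm : ¬ IsSquare m) {a b : ℚ} (h : (a : ℝ) + b * √m ≠ 0) :
    ((a : ℝ) + b * √m)⁻¹ =
      ((a / (a ^ 2 - m * b ^ 2) : ℚ) : ℝ) + ((-b / (a ^ 2 - m * b ^ 2) : ℚ) : ℝ) * √m := by
  have h1 := quadraticNorm_ne_zero hm h
  have h2 : (a : ℝ) ^ 2 - m * b ^ 2 ≠ 0 := by exact_mod_cast h1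
  apply inv_eq_of_mul_eq_one_right
  push_cast
  rw [div_mul_eq_mul_div, ← add_div, mul_div_assoc', div_eq_one_iff_eq h2]
  linear_combination (-(b : ℝ) ^ 2) * sq_sqrt_natCast m

namespace IsQuadraticUnit

variable {m : ℕ} {x y : ℝ}

theorem mul (hx : IsQuadraticUnit m x) (hy : IsQuadraticUnit m y) : IsQuadraticUnit m (x * y) := by
  obtain ⟨h0, h1, h2, a, b, h3⟩ := hx
  obtain ⟨g0, g1, g2, c, d, g3⟩ := hy
  refine ⟨mul_ne_zero h0 g0, h1.mul g1, by rw [mul_inv]; exact h2.mul g2,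
    a * c + m * b * d, a * d + b * c, ?_⟩
  rw [h3, g3]
  push_cast
  linear_combination ((b : ℝ) * d) * sq_sqrt_natCast m

theorem inv (hm : ¬ IsSquare m) (hx : IsQuadraticUnit m x) : IsQuadraticUnit m x⁻¹ := by
  obtain ⟨h0, h1, h2, a, b, h3⟩ := hx
  refine ⟨inv_ne_zero h0, h2, by rwa [inv_inv], ?_⟩
  rw [h3]
  exact ⟨_, _, inv_add_mul_sqrt hm (h3 ▸ h0)⟩

theorem one : IsQuadraticUnit m 1 :=
  ⟨one_ne_zero, isIntegral_one, by rw [inv_one]; exact isIntegral_one, 1, 0, by simp⟩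

theorem neg (hx : IsQuadraticUnit m x) : IsQuadraticUnit m (-x) := by
  obtain ⟨h0, h1, h2, a, b, h3⟩ := hx
  exact ⟨neg_ne_zero.2 h0, h1.neg, by rw [inv_neg]; exact h2.neg, -a, -b, by rw [h3]; push_cast; ring⟩

theorem pow (hx : IsQuadraticUnit m x) (n : ℕ) : IsQuadraticUnit m (x ^ n) := by
  induction n with
  | zero => simpa using one
  | succ n ih => rw [pow_succ]; exact ih.mul hx

theorem zpow (hm : ¬ IsSquare m) (hx : IsQuadraticUnit m x) (n : ℤ) :
    IsQuadraticUnit m (x ^ n) := by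
  cases n with
  | ofNat n => simpa using hx.pow n
  | negSucc n => rw [zpow_negSucc]; exact (hx.pow _).inv hm

theorem of_norm {a b : ℚ} {T : ℤ} (h0 : 2 * a = T) (h : a ^ 2 - m * b ^ 2 = 1 ∨ a ^ 2 - m * b ^ 2 = -1) :
    IsQuadraticUnit m (a + b * √m) := by
  obtain ⟨N, hN, hN'⟩ : ∃ N : ℤ, N * N = 1 ∧ a ^ 2 - m * b ^ 2 = N := by
    rcases h with h | h
    · exact ⟨1, by norm_num, by simpa using h⟩
    · exact ⟨-1, by norm_num, by simpa using h⟩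
  have h0' : 2 * (a : ℝ) = T := by exact_mod_cast h0
  have hN2 : (a : ℝ) ^ 2 - m * b ^ 2 = N := by exact_mod_cast hN'
  have hNN : (N : ℝ) * N = 1 := by exact_mod_cast hN
  have hs := sq_sqrt_natCast m
  -- The choices `c = b` and `c = -b` give the element and its conjugate, the roots of X² - TX + N.
  have key (c : ℚ) (hc : c ^ 2 = b ^ 2) : IsIntegral ℤ ((a : ℝ) + c * √m) := by
    refine ⟨Polynomial.X ^ 2 + (Polynomial.C (-T) * Polynomial.X + Polynomial.C N), ?_, ?_⟩
    · apply Polynomial.monic_X_pow_add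
      exact lt_of_le_of_lt Polynomial.degree_linear_le (by norm_num)
    · have hc' : (c : ℝ) ^ 2 = b ^ 2 := by exact_mod_cast hc
      simp only [Polynomial.eval₂_add, Polynomial.eval₂_mul, Polynomial.eval₂_C,
        Polynomial.eval₂_X, Polynomial.eval₂_X_pow]
      simp only [eq_intCast, Int.cast_neg]
      linear_combination (-(a : ℝ) - c * √m) * (-h0') - hN2 + (c : ℝ) ^ 2 * hs + m * hc'
  have hprod : ((a : ℝ) + b * √m) * (N * (a + (-b : ℚ) * √m)) = 1 := by
    push_cast
    linear_combination (-(N : ℝ) * b ^ 2) * hs + N * hN2 + hNN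
  have hne : ((a : ℝ) + b * √m) ≠ 0 := left_ne_zero_of_mul_eq_one hprod
  refine ⟨hne, key b rfl, ?_, a, b, rfl⟩
  rw [inv_eq_of_mul_eq_one_right hprod]
  exact isIntegral_algebraMap.mul (key (-b) (by ring))

/-- The conjugate is integral too, so the trace 2a and the norms of x and x⁻¹ are rational integers;
these norms multiply to 1. -/
theorem norm_eq (hm : ¬ IsSquare m) {a b : ℚ} (hx : IsQuadraticUnit m (a + b * √m)) :
    (∃ T : ℤ, 2 * a = T) ∧ (a ^ 2 - m * b ^ 2 = 1 ∨ a ^ 2 - m * b ^ 2 = -1) := by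
  obtain ⟨h0, h1, h2, -⟩ := hx
  rw [inv_add_mul_sqrt hm h0] at h2
  have hs := sq_sqrt_natCast m
  have conj {c e : ℚ} (h : IsIntegral ℤ ((c : ℝ) + e * √m)) : IsIntegral ℤ ((c : ℝ) - e * √m) := by
    have := IsIntegral.map_of_injective (quadraticEval m _ (sq_sqrt_natCast m))
      (quadraticEval m _ (neg_sqrt_sq_natCast m)) (quadraticEval_injective hm _)
      (z := ⟨c, e⟩) h
    rw [quadraticEval_apply] at this
    simpa [sub_eq_add_neg] using this
  have hN {c e : ℚ} (h : IsIntegral ℤ ((c : ℝ) + e * √m)) :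
      IsIntegral ℤ ((c ^ 2 - m * e ^ 2 : ℚ) : ℝ) := by
    have h' : ((c ^ 2 - m * e ^ 2 : ℚ) : ℝ) = ((c : ℝ) + e * √m) * (c - e * √m) := by
      push_cast
      linear_combination ((e : ℝ) ^ 2) * hs
    rw [h']
    exact h.mul (conj h)
  refine ⟨?_, rat_eq_one_or_neg_one (hN h1) (hN h2) ?_⟩
  · apply exists_int_of_isIntegral
    have h' : ((2 * a : ℚ) : ℝ) = ((a : ℝ) + b * √m) + (a - b * √m) := by
      push_cast
      ring
    rw [h']
    exact h1.add (conj h1)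
  · have := quadraticNorm_ne_zero hm h0
    field_simp

end IsQuadraticUnit

/-- The smallest `x > 1` that is a unit of `ℚ(√m)` exists. -/
theorem exists_isLeast_quadraticUnit {m : ℕ} (hm : ¬ IsSquare m) :
    ∃ e, IsLeast {x : ℝ | 1 < x ∧ IsQuadraticUnit m x} e := by
  have hm0 : 0 < m := by
    rcases Nat.eq_zero_or_pos m with rfl | h
    · exact absurd (IsSquare.zero) hm
    · exact h
  have hs := sq_sqrt_natCast m
  have hspos : 1 ≤ √(m : ℝ) := Real.one_le_sqrt.2 (by exact_mod_cast hm0)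
  obtain ⟨x0, hx0⟩ : ∃ x0, x0 ∈ {x : ℝ | 1 < x ∧ IsQuadraticUnit m x} := by
    obtain ⟨x, y, h, hy⟩ := Pell.exists_of_not_isSquare (d := m) (by exact_mod_cast hm0)
      (by rwa [Int.isSquare_natCast_iff])
    have hu : IsQuadraticUnit m (((|x| : ℤ) : ℚ) + ((|y| : ℤ) : ℚ) * √m) := by
      refine IsQuadraticUnit.of_norm (a := ((|x| : ℤ) : ℚ)) (T := 2 * |x|) (by push_cast; ring) (Or.inl ?_)
      have : |x| ^ 2 - m * |y| ^ 2 = 1 := by simpa using h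
      exact_mod_cast this
    refine ⟨_, ?_, hu⟩
    have hy' : (1 : ℝ) ≤ ((|y| : ℤ) : ℚ) := by
      have : 1 ≤ |y| := Int.one_le_abs hy
      exact_mod_cast this
    have hx' : (1 : ℝ) ≤ ((|x| : ℤ) : ℚ) := by
      have : x ≠ 0 := by
        rintro rfl
        have h1 : (m : ℤ) * y ^ 2 = -1 := by linarith
        nlinarith [sq_nonneg y, (Int.natCast_nonneg m)]
      have : 1 ≤ |x| := Int.one_le_abs this
      exact_mod_cast this
    nlinarith
  -- A unit in (1, x0] has a conjugate of absolute value below 1, which bounds its trace T. It is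
  -- the larger root of X² - TX + N with N = ±1, so finitely many pairs (T, N) account for all of
  -- them.
  have hfin : ({x : ℝ | 1 < x ∧ IsQuadraticUnit m x} ∩ Set.Iic x0).Finite := by
    obtain ⟨n, hn⟩ := exists_nat_ge (x0 + 1)
    refine ((((Finset.Icc (-(n : ℤ)) n) ×ˢ ({1, -1} : Finset ℤ)).image
      (fun p : ℤ × ℤ => ((p.1 : ℝ) + √((p.1 : ℝ) ^ 2 - 4 * p.2)) / 2)).finite_toSet).subset ?_
    rintro x ⟨⟨hx1, hx⟩, hxx0⟩
    obtain ⟨a, b, rfl⟩ := hx.2.2.2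
    obtain ⟨⟨T, hT⟩, hN⟩ := hx.norm_eq hm
    obtain ⟨N, hNmem, hN'⟩ : ∃ N : ℤ, (N = 1 ∨ N = -1) ∧ a ^ 2 - m * b ^ 2 = N := by
      rcases hN with h | h
      · exact ⟨1, by norm_num, by simpa using h⟩
      · exact ⟨-1, by norm_num, by simpa using h⟩
    have hT' : 2 * (a : ℝ) = T := by exact_mod_cast hT
    have hN2 : (a : ℝ) ^ 2 - m * b ^ 2 = N := by exact_mod_cast hN'
    have hprod : ((a : ℝ) + b * √m) * (a - b * √m) = N := by
      linear_combination (-(b : ℝ) ^ 2) * hs + hN2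
    have habs : |(a : ℝ) - b * √m| < 1 := by
      have : |(a : ℝ) + b * √m| * |(a : ℝ) - b * √m| = 1 := by
        rw [← abs_mul, hprod]
        rcases hNmem with rfl | rfl <;> simp
      rw [abs_of_pos (by linarith)] at this
      nlinarith [abs_nonneg ((a : ℝ) - b * √m)]
    rw [abs_lt] at habs
    have hle : (a : ℝ) + b * √m ≤ x0 := hxx0
    simp only [Finset.coe_image, Set.mem_image]
    refine ⟨(T, N), ?_, ?_⟩
    · simp only [Finset.coe_product, Set.mem_prod, Finset.mem_coe, Finset.mem_Icc]
      refine ⟨⟨?_, ?_⟩, by simpa using hNmem⟩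
      · have : (-(n : ℝ)) ≤ T := by rw [← hT']; linarith
        exact_mod_cast this
      · have : (T : ℝ) ≤ n := by rw [← hT']; linarith
        exact_mod_cast this
    · have : √((T : ℝ) ^ 2 - 4 * N) = 2 * (b * √m) := by
        rw [Real.sqrt_eq_iff_mul_self_eq_of_pos (by linarith)]
        linear_combination (-4 : ℝ) * hprod + (2 * a + T) * hT'
      rw [this, ← hT']
      ring
  obtain ⟨e, he, hmin⟩ := Set.exists_min_image _ id hfin ⟨x0, hx0, le_refl x0⟩
  refine ⟨e, he.1, fun x hx => ?_⟩
  rcases le_total x x0 with h | h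
  · exact hmin x ⟨hx, h⟩
  · exact le_trans he.2 h

/-! ### Unit groups inside ℂ and the fundamental unit -/

theorem isIntegral_ofReal_iff {x : ℝ} : IsIntegral ℤ (x : ℂ) ↔ IsIntegral ℤ x :=
  isIntegral_algebraMap_iff (algebraMap ℝ ℂ).injective

theorem mem_unitGroupIn_iff {K : IntermediateField ℚ ℂ} {u : ℂˣ} :
    u ∈ unitGroupIn K ↔ (u : ℂ) ∈ K ∧ IsIntegral ℤ (u : ℂ) ∧ IsIntegral ℤ ((u : ℂ)⁻¹) := by
  constructor
  · rintro ⟨v, rfl⟩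
    refine ⟨?_, ?_, ?_⟩
    · exact ((v : 𝓞 K) : K).2
    · exact (RingOfIntegers.isIntegral_coe (v : 𝓞 K)).map (algebraMap K ℂ).toIntAlgHom
    · rw [← Units.val_inv_eq_inv_val, ← map_inv]
      exact (RingOfIntegers.isIntegral_coe ((v⁻¹ : (𝓞 K)ˣ) : 𝓞 K)).map (algebraMap K ℂ).toIntAlgHom
  · rintro ⟨h1, h2, h3⟩
    have i1 : IsIntegral ℤ (⟨u, h1⟩ : K) :=
      (isIntegral_algebraMap_iff (algebraMap K ℂ).injective).1 h2
    have i2 : IsIntegral ℤ (⟨u, h1⟩⁻¹ : K) :=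
      (isIntegral_algebraMap_iff (algebraMap K ℂ).injective).1 (by simpa using h3)
    have hne : (⟨u, h1⟩ : K) ≠ 0 := by
      intro h
      exact u.ne_zero (congrArg Subtype.val h)
    refine ⟨⟨⟨⟨u, h1⟩, i1⟩, ⟨⟨u, h1⟩⁻¹, i2⟩, ?_, ?_⟩, ?_⟩
    · apply RingOfIntegers.ext
      exact mul_inv_cancel₀ hne
    · apply RingOfIntegers.ext
      exact inv_mul_cancel₀ hne
    · apply Units.ext
      rfl

theorem isAlgebraic_of_sq_eq {z : ℂ} {q : ℚ} (h : z ^ 2 = q) : IsAlgebraic ℚ z := by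
  refine ⟨Polynomial.X ^ 2 - Polynomial.C q, ?_, by simp [h]⟩
  exact (Polynomial.monic_X_pow_sub_C q two_ne_zero).ne_zero

theorem mem_quadraticFieldIn_iff {m : ℕ} {z : ℂ} :
    z ∈ quadraticFieldIn m ↔ ∃ a b : ℚ, z = ((a + b * √m : ℝ) : ℂ) := by
  have hs : ((√m : ℝ) : ℂ) ^ 2 = m := by exact_mod_cast sq_sqrt_natCast m
  constructor
  · intro hz
    let B : Subalgebra ℚ ℂ :=
      { carrier := {z | ∃ a b : ℚ, z = ((a + b * √m : ℝ) : ℂ)}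
        mul_mem' := by
          rintro _ _ ⟨a, b, rfl⟩ ⟨c, e, rfl⟩
          refine ⟨a * c + m * b * e, a * e + b * c, ?_⟩
          push_cast
          linear_combination ((b : ℂ) * e) * hs
        add_mem' := by
          rintro _ _ ⟨a, b, rfl⟩ ⟨c, e, rfl⟩
          exact ⟨a + c, b + e, by push_cast; ring⟩
        algebraMap_mem' := fun q => ⟨q, 0, by simp⟩ }
    have h1 : z ∈ (quadraticFieldIn m).toSubalgebra := hz
    rw [quadraticFieldIn, IntermediateField.adjoin_toSubalgebra_of_isAlgebraic] at h1
    · have : Algebra.adjoin ℚ {z : ℂ | z ^ 2 = (m : ℂ)} ≤ B := by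
        apply Algebra.adjoin_le
        intro w (hw : w ^ 2 = m)
        rw [← hs, sq_eq_sq_iff_eq_or_eq_neg] at hw
        rcases hw with rfl | rfl
        · exact ⟨0, 1, by simp⟩
        · exact ⟨0, -1, by simp⟩
      exact this h1
    · intro w hw
      exact isAlgebraic_of_sq_eq (q := m) (by simpa using hw)
  · rintro ⟨a, b, rfl⟩
    have : ((√m : ℝ) : ℂ) ∈ quadraticFieldIn m := subset_adjoin _ _ hs
    push_cast
    exact add_mem (SubfieldClass.ratCast_mem _ _) (mul_mem (SubfieldClass.ratCast_mem _ _) this)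

theorem ofReal_mem_unitGroupIn_quadraticFieldIn {m : ℕ} {u : ℂˣ} {x : ℝ} (h : (u : ℂ) = x) :
    u ∈ unitGroupIn (quadraticFieldIn m) ↔ IsQuadraticUnit m x := by
  rw [mem_unitGroupIn_iff, h, mem_quadraticFieldIn_iff, ← Complex.ofReal_inv,
    isIntegral_ofReal_iff, isIntegral_ofReal_iff]
  have hx : x ≠ 0 := by
    rintro rfl
    simp at h
  simp only [Complex.ofReal_inj]
  constructor
  · rintro ⟨h1, h2, h3⟩
    exact ⟨hx, h2, h3, h1⟩
  · rintro ⟨-, h2, h3, h1⟩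
    exact ⟨h1, h2, h3⟩

theorem fundamentalUnit_isLeast {m : ℕ} (hm : ¬ IsSquare m) :
    IsLeast {x : ℝ | 1 < x ∧ IsQuadraticUnit m x} (fundamentalUnit m) := by
  have heq : {x : ℝ | 1 < x ∧ ∃ u ∈ unitGroupIn (quadraticFieldIn m), (u : ℂ) = (x : ℂ)} =
      {x : ℝ | 1 < x ∧ IsQuadraticUnit m x} := by
    ext x
    refine and_congr_right fun hx => ?_
    constructor
    · rintro ⟨u, hu, hux⟩
      exact (ofReal_mem_unitGroupIn_quadraticFieldIn hux).1 hu
    · intro h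
      exact ⟨Units.mk0 (x : ℂ) (by exact_mod_cast h.1),
        (ofReal_mem_unitGroupIn_quadraticFieldIn rfl).2 h, rfl⟩
  obtain ⟨e, he⟩ := exists_isLeast_quadraticUnit hm
  rw [fundamentalUnit, heq, he.csInf_eq]
  exact he

theorem one_lt_fundamentalUnit {m : ℕ} (hm : ¬ IsSquare m) : 1 < fundamentalUnit m :=
  (fundamentalUnit_isLeast hm).1.1

theorem isQuadraticUnit_fundamentalUnit {m : ℕ} (hm : ¬ IsSquare m) :
    IsQuadraticUnit m (fundamentalUnit m) :=
  (fundamentalUnit_isLeast hm).1.2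

/-- If ε^k < x < ε^(k+1), then x/ε^k is a unit strictly between 1 and ε, against minimality. -/
theorem IsQuadraticUnit.exists_zpow_of_pos {m : ℕ} (hm : ¬ IsSquare m) {x : ℝ}
    (hx : IsQuadraticUnit m x) (h0 : 0 < x) : ∃ k : ℤ, x = fundamentalUnit m ^ k := by
  have h1 := one_lt_fundamentalUnit hm
  have hpos : 0 < fundamentalUnit m := by linarith
  obtain ⟨k, hk1, hk2⟩ := exists_mem_Ico_zpow h0 h1
  refine ⟨k, ?_⟩
  by_contra hne
  have hlt : fundamentalUnit m ^ k < x := lt_of_le_of_ne hk1 (Ne.symm hne)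
  have hu : IsQuadraticUnit m (x * (fundamentalUnit m ^ k)⁻¹) :=
    hx.mul (((isQuadraticUnit_fundamentalUnit hm).zpow hm k).inv hm)
  have hkpos : 0 < fundamentalUnit m ^ k := zpow_pos hpos k
  have := (fundamentalUnit_isLeast hm).2 ⟨by
    rw [← div_eq_mul_inv, lt_div_iff₀ hkpos]; linarith, hu⟩
  rw [← div_eq_mul_inv, le_div_iff₀ hkpos] at this
  rw [zpow_add_one₀ hpos.ne'] at hk2
  linarith

theorem IsQuadraticUnit.exists_zpow {m : ℕ} (hm : ¬ IsSquare m) {x : ℝ}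
    (hx : IsQuadraticUnit m x) : ∃ k : ℤ, x = fundamentalUnit m ^ k ∨ x = -fundamentalUnit m ^ k := by
  rcases lt_or_gt_of_ne hx.1 with h | h
  · obtain ⟨k, hk⟩ := hx.neg.exists_zpow_of_pos hm (by linarith)
    exact ⟨k, Or.inr (by rw [← hk]; ring)⟩
  · obtain ⟨k, hk⟩ := hx.exists_zpow_of_pos hm h
    exact ⟨k, Or.inl hk⟩

/-! ### Square roots of fundamental units -/

/-- As A and A + 1 are coprime, D is the product of its gcds with them. The two cofactors are
coprime with product z², so each is a square. -/
theorem exists_sq_of_mul_succ_eq {A D z : ℕ} (hD : 0 < D) (h : A * (A + 1) = D * z ^ 2) :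
    ∃ a b u v : ℕ, a * b = D ∧ A = a * u ^ 2 ∧ A + 1 = b * v ^ 2 ∧ z = u * v := by
  have hcop : Nat.Coprime A (A + 1) := by simp
  have hab : Nat.gcd D A * Nat.gcd D (A + 1) = D := by
    rw [← Nat.Coprime.gcd_mul D hcop, h]
    exact Nat.gcd_eq_left ⟨z ^ 2, rfl⟩
  obtain ⟨A', hA⟩ := Nat.gcd_dvd_right D A
  obtain ⟨B', hB⟩ := Nat.gcd_dvd_right D (A + 1)
  generalize Nat.gcd D A = a at *
  generalize Nat.gcd D (A + 1) = b at *
  have hz : A' * B' = z ^ 2 := by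
    apply Nat.eq_of_mul_eq_mul_left hD
    rw [← h]
    conv_rhs => rw [hB]
    conv_rhs => rw [hA]
    rw [← hab]
    ring
  have hcop' : Nat.Coprime A' B' :=
    Nat.Coprime.of_dvd ⟨a, by rw [hA]; ring⟩ ⟨b, by rw [hB]; ring⟩ hcop
  obtain ⟨u, hu⟩ := exists_eq_pow_of_mul_eq_pow (Nat.isUnit_iff.2 hcop') hz
  obtain ⟨v, hv⟩ := exists_eq_pow_of_mul_eq_pow (Nat.isUnit_iff.2 hcop'.symm)
    (by rw [mul_comm]; exact hz)
  refine ⟨a, b, u, v, hab, by rw [← hu]; exact hA, by rw [← hv]; exact hB, ?_⟩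
  apply Nat.pow_left_injective two_ne_zero
  simp only
  rw [← hz, hu, hv]
  ring

/-- A quadratic unit `x + y√m` of norm `1` with `x` odd and `y` even has a square root of the
form `v√b + u√a` with `ab = m`; for the fundamental unit, `b ≠ 1`. -/
theorem exists_sqrt_fundamentalUnit {m : ℕ} (hm : ¬ IsSquare m) {x y : ℤ}
    (h : fundamentalUnit m = x + y * √m) (hn : x ^ 2 - m * y ^ 2 = 1) (hx : Odd x) (hy : Even y) :
    ∃ a b u v : ℕ, a * b = m ∧ b * v ^ 2 = a * u ^ 2 + 1 ∧ b ≠ 1 ∧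
      √(fundamentalUnit m) = v * √b + u * √a := by
  have hs := sq_sqrt_natCast m
  have h1 := one_lt_fundamentalUnit hm
  have hm0 : 0 < m := by
    rcases Nat.eq_zero_or_pos m with rfl | h
    · exact absurd (IsSquare.zero) hm
    · exact h
  have hspos : 0 < √(m : ℝ) := Real.sqrt_pos.2 (by exact_mod_cast hm0)
  have hn' : (x : ℝ) ^ 2 - m * y ^ 2 = 1 := by exact_mod_cast hn
  have hprod : ((x : ℝ) + y * √m) * (x - y * √m) = 1 := by
    linear_combination (-(y : ℝ) ^ 2) * hs + hn'
  rw [h] at h1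
  have hc0 : 0 < (x : ℝ) - y * √m := by
    by_contra hc
    nlinarith
  have hc1 : (x : ℝ) - y * √m < 1 := by nlinarith
  have hx0 : 0 < x := by
    have : (0 : ℝ) < x := by linarith
    exact_mod_cast this
  have hy0 : 0 < y := by
    have : (0 : ℝ) < y := by
      by_contra hc
      nlinarith
    exact_mod_cast this
  -- With x = 2A + 1 and y = 2z the norm equation becomes A(A + 1) = mz².
  obtain ⟨A, hA⟩ := hx
  obtain ⟨z, hz⟩ := hy
  lift A to ℕ using by omega
  lift z to ℕ using by omega
  have hAz : A * (A + 1) = m * z ^ 2 := by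
    rw [hA, hz] at hn
    have : (4 : ℤ) * (A * (A + 1)) = 4 * (m * z ^ 2) := by linear_combination hn
    have := mul_left_cancel₀ (by norm_num) this
    exact_mod_cast this
  obtain ⟨a, b, u, v, hab, hu, hv, huv⟩ := exists_sq_of_mul_succ_eq hm0 hAz
  have hbv : b * v ^ 2 = a * u ^ 2 + 1 := by rw [← hu, ← hv]
  have hab' : √(a : ℝ) * √b = √m := by
    rw [← hab, Nat.cast_mul, Real.sqrt_mul (Nat.cast_nonneg a)]
  have hsq : ((v : ℝ) * √b + u * √a) ^ 2 = fundamentalUnit m := by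
    have e1 : (A : ℝ) = a * u ^ 2 := by exact_mod_cast hu
    have e2 : (A : ℝ) + 1 = b * v ^ 2 := by exact_mod_cast hv
    have e3 : (z : ℝ) = u * v := by exact_mod_cast huv
    rw [h, hA, hz]
    push_cast
    linear_combination (v : ℝ) ^ 2 * sq_sqrt_natCast b + (u : ℝ) ^ 2 * sq_sqrt_natCast a +
      2 * u * v * hab' - e1 - e2 - 2 * √m * e3
  have hnn : 0 ≤ (v : ℝ) * √b + u * √a := by positivity
  refine ⟨a, b, u, v, hab, hbv, ?_, ?_⟩
  -- If b = 1, then v + u√m is itself a unit above 1 whose square is the fundamental unit,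
  -- contradicting minimality.
  · rintro rfl
    obtain rfl : a = m := by simpa using hab
    have hz0 : 0 < z := by omega
    have hu0 : 0 < u := Nat.pos_of_ne_zero (by rintro rfl; simp at huv; omega)
    have hv0 : 0 < v := Nat.pos_of_ne_zero (by rintro rfl; simp at huv; omega)
    have hunit : IsQuadraticUnit a ((v : ℚ) + (u : ℚ) * √a) := by
      refine IsQuadraticUnit.of_norm (a := v) (b := u) (T := 2 * v) (by push_cast; ring) (Or.inl ?_)
      have : (v : ℚ) ^ 2 = a * u ^ 2 + 1 := by exact_mod_cast (by simpa using hbv : v ^ 2 = _)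
      linarith
    push_cast at hunit
    have hv1 : (1 : ℝ) ≤ v := by exact_mod_cast hv0
    have hu1 : (1 : ℝ) ≤ u := by exact_mod_cast hu0
    have hgt : 1 < (v : ℝ) + u * √a := by nlinarith
    have hle := (fundamentalUnit_isLeast hm).2 ⟨hgt, hunit⟩
    rw [← hsq] at hle
    simp at hle
    nlinarith
  · rw [← hsq, Real.sqrt_sq hnn]

theorem eq_mul_or_eq_mul_of_mul_eq {p a b m : ℕ} (hp : p.Prime) (h : a * b = p * m) :
    (∃ a', a = p * a' ∧ a' * b = m) ∨ (∃ b', b = p * b' ∧ a * b' = m) := by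
  rcases hp.dvd_mul.1 (⟨m, h⟩ : p ∣ a * b) with ⟨a', rfl⟩ | ⟨b', rfl⟩
  · exact Or.inl ⟨a', rfl, Nat.eq_of_mul_eq_mul_left hp.pos (by rw [← h]; ring)⟩
  · exact Or.inr ⟨b', rfl, Nat.eq_of_mul_eq_mul_left hp.pos (by rw [← h]; ring)⟩

theorem Nat.Prime.not_dvd_sq_add_one {q : ℕ} (hq : q.Prime) (h : q % 4 = 3) (x : ℤ) :
    ¬ (q : ℤ) ∣ x ^ 2 + 1 := by
  have := Fact.mk hq
  intro hd
  rw [← ZMod.intCast_zmod_eq_zero_iff_dvd] at hd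
  apply ZMod.exists_sq_eq_neg_one_iff.1 (⟨(x : ZMod q), _⟩ : IsSquare (-1 : ZMod q)) h
  push_cast at hd
  linear_combination -hd

/-- The number Dr is an integer because (Dr)² = Dn; then D divides its square, hence divides it, D
being squarefree. -/
theorem exists_int_of_squarefree_mul_sq {D : ℕ} (hD : Squarefree D) {r : ℚ} {n : ℤ}
    (h : D * r ^ 2 = n) : ∃ k : ℤ, r = k := by
  have hD0 : (D : ℚ) ≠ 0 := by exact_mod_cast hD.ne_zero
  have h1 : IsIntegral ℤ ((D : ℚ) * r) := by
    apply IsIntegral.of_pow (n := 2) two_pos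
    have : ((D : ℚ) * r) ^ 2 = algebraMap ℤ ℚ (D * n) := by simp [← h]; ring
    rw [this]
    exact isIntegral_algebraMap
  obtain ⟨Z, hZ⟩ := IsIntegrallyClosed.isIntegral_iff.1 h1
  have hZ' : (Z : ℚ) = D * r := by simpa using hZ
  have hZ2 : Z ^ 2 = D * n := by
    have : (Z : ℚ) ^ 2 = D * n := by rw [hZ', ← h]; ring
    exact_mod_cast this
  have hdvd : (D : ℤ) ∣ Z := by
    rw [← (Int.squarefree_natCast.2 hD).dvd_pow_iff_dvd two_ne_zero]
    exact ⟨n, hZ2⟩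
  obtain ⟨k, rfl⟩ := hdvd
  refine ⟨k, ?_⟩
  push_cast at hZ'
  exact (mul_left_cancel₀ hD0 hZ').symm

/-- The class of 4x in `ZMod 8` encodes the parity of x, so that parity claims can be settled there
by `decide`. -/
theorem even_of_four_mul_eq_zero {x : ℤ} (h : (4 * x : ZMod 8) = 0) : Even x := by
  have : ((4 * x : ℤ) : ZMod 8) = 0 := by push_cast; exact h
  rw [ZMod.intCast_zmod_eq_zero_iff_dvd] at this
  rw [Int.even_iff]
  push_cast at this
  omega

theorem odd_of_four_mul_eq_four {x : ℤ} (h : (4 * x : ZMod 8) = 4) : Odd x := by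
  have : ((4 * x - 4 : ℤ) : ZMod 8) = 0 := by push_cast; rw [h]; ring
  rw [ZMod.intCast_zmod_eq_zero_iff_dvd] at this
  rw [Int.odd_iff]
  push_cast at this
  omega

/-- If `m ≡ 1, 2 (mod 8)` is squarefree and divisible by a prime `q ≡ 3 (mod 4)`, then the
units of `ℚ(√m)` are the `x + y√m` with integers satisfying `x² - m y² = 1`, and here `x` is odd
and `y` is even. -/
theorem IsQuadraticUnit.exists_int {m q : ℕ} (hm : Squarefree m) (hsq : ¬ IsSquare m)
    (h8 : m % 8 = 1 ∨ m % 8 = 2) (hq : q.Prime) (hq4 : q % 4 = 3) (hqm : q ∣ m) {x : ℝ}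
    (hx : IsQuadraticUnit m x) :
    ∃ a b : ℤ, x = a + b * √m ∧ a ^ 2 - m * b ^ 2 = 1 ∧ Odd a ∧ Even b := by
  obtain ⟨a, b, rfl⟩ := hx.2.2.2
  obtain ⟨⟨T, hT⟩, hN⟩ := hx.norm_eq hsq
  obtain ⟨N, hNmem, hN'⟩ : ∃ N : ℤ, (N = 1 ∨ N = -1) ∧ a ^ 2 - m * b ^ 2 = N := by
    rcases hN with h | h
    · exact ⟨1, by norm_num, by simpa using h⟩
    · exact ⟨-1, by norm_num, by simpa using h⟩
  obtain ⟨Y, hY⟩ := exists_int_of_squarefree_mul_sq hm (r := 2 * b) (n := T ^ 2 - 4 * N) (by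
    push_cast; rw [← hT, ← hN']; ring)
  have hTY : T ^ 2 - m * Y ^ 2 = 4 * N := by
    have : (T : ℚ) ^ 2 - m * Y ^ 2 = 4 * N := by rw [← hT, ← hY, ← hN']; ring
    exact_mod_cast this
  have hm8 : (m : ZMod 8) = 1 ∨ (m : ZMod 8) = 2 := by
    rcases h8 with h | h
    · left; exact_mod_cast (ZMod.natCast_eq_natCast_iff' m 1 8).2 h
    · right; exact_mod_cast (ZMod.natCast_eq_natCast_iff' m 2 8).2 h
  have hTY8 : (T : ZMod 8) ^ 2 - m * (Y : ZMod 8) ^ 2 = 4 := by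
    have := congrArg (Int.cast : ℤ → ZMod 8) hTY
    push_cast at this
    rw [this]
    rcases hNmem with rfl | rfl <;> decide
  -- For m ≡ 1, 2 mod 8 the congruence T² - mY² ≡ 4 mod 8 forces T and Y to be even, so a and b are
  -- integers.
  have heven : (4 * T : ZMod 8) = 0 ∧ (4 * Y : ZMod 8) = 0 := by
    revert hTY8
    generalize (T : ZMod 8) = t
    generalize (Y : ZMod 8) = y
    rcases hm8 with h | h <;> rw [h] <;> revert t y <;> decide
  obtain ⟨t, ht⟩ := even_of_four_mul_eq_zero heven.1
  obtain ⟨y, hy⟩ := even_of_four_mul_eq_zero heven.2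
  obtain rfl : a = t := by
    rw [ht] at hT; push_cast at hT; linarith
  obtain rfl : b = y := by
    rw [hy] at hY; push_cast at hY; linarith
  have hint : t ^ 2 - m * y ^ 2 = N := by exact_mod_cast hN'
  -- Norm -1 would make q divide t² + 1, while -1 is not a square mod q.
  obtain rfl : N = 1 := by
    rcases hNmem with rfl | rfl
    · rfl
    · exfalso
      apply hq.not_dvd_sq_add_one hq4 t
      have : t ^ 2 + 1 = m * y ^ 2 := by linarith
      rw [this]
      exact Dvd.dvd.mul_right (by exact_mod_cast hqm) _
  have h3 : (4 * t : ZMod 8) = 4 ∧ (4 * y : ZMod 8) = 0 := by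
    have := congrArg (Int.cast : ℤ → ZMod 8) hint
    push_cast at this
    revert this
    generalize (t : ZMod 8) = t
    generalize (y : ZMod 8) = y
    rcases hm8 with h | h <;> rw [h] <;> revert t y <;> decide
  exact ⟨t, y, by push_cast; rfl, hint, odd_of_four_mul_eq_four h3.1,
    even_of_four_mul_eq_zero h3.2⟩

/-- If ε₂ had norm 1, so would all its powers; but the positive unit 1 + √2 is one of them and has
norm -1. -/
theorem exists_norm_fundamentalUnit_two :
    ∃ a b : ℚ, fundamentalUnit 2 = a + b * √2 ∧ a ^ 2 - 2 * b ^ 2 = -1 := by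
  have hsq : ¬ IsSquare (2 : ℕ) := by
    have := Nat.prime_two.not_isSquare_mul (m := 1) (by norm_num)
    simpa using this
  have hu := isQuadraticUnit_fundamentalUnit hsq
  have h1 := one_lt_fundamentalUnit hsq
  obtain ⟨a, b, hab⟩ := hu.2.2.2
  refine ⟨a, b, by simpa using hab, ?_⟩
  rw [hab] at hu
  rcases (hu.norm_eq hsq).2 with h | h
  · exfalso
    have h12 : IsQuadraticUnit 2 ((1 : ℚ) + (1 : ℚ) * √(2 : ℕ)) :=
      IsQuadraticUnit.of_norm (T := 2) (by norm_num) (Or.inr (by norm_num))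
    obtain ⟨k, hk⟩ := h12.exists_zpow_of_pos hsq (by positivity)
    have hk0 : 0 ≤ k := by
      by_contra hk0
      have : fundamentalUnit 2 ^ k ≤ 1 := zpow_le_one_of_nonpos₀ h1.le (by omega)
      rw [← hk] at this
      have : 0 < √((2 : ℕ) : ℝ) := by positivity
      push_cast at *
      linarith
    lift k to ℕ using hk0
    rw [zpow_natCast, hab] at hk
    have hz : (⟨1, 1⟩ : QuadraticAlgebra ℚ ((2 : ℕ) : ℚ) 0) = ⟨a, b⟩ ^ k := by
      apply quadraticEval_injective hsq (sq_sqrt_natCast 2)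
      rw [map_pow]
      exact hk
    have hn := congrArg QuadraticAlgebra.norm hz
    rw [map_pow] at hn
    simp only [QuadraticAlgebra.norm_def] at hn
    have h' : a * a + 0 * a * b - ((2 : ℕ) : ℚ) * b * b = 1 := by rw [← h]; ring
    rw [h'] at hn
    norm_num at hn
  · simpa using h

section primes

variable {q₁ q₂ : ℕ}

theorem not_isSquare_mul_of_prime (hp₁ : q₁.Prime) (hp₂ : q₂.Prime) (hne : q₁ ≠ q₂) :
    ¬ IsSquare (q₁ * q₂) :=
  hp₁.not_isSquare_mul fun h => hne ((Nat.prime_dvd_prime_iff_eq hp₁ hp₂).1 h)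

theorem squarefree_mul_of_prime (hp₁ : q₁.Prime) (hp₂ : q₂.Prime) (hne : q₁ ≠ q₂) :
    Squarefree (q₁ * q₂) :=
  (Nat.squarefree_mul ((Nat.coprime_primes hp₁ hp₂).2 hne)).2 ⟨hp₁.squarefree, hp₂.squarefree⟩

theorem squarefree_two_mul_mul_of_prime (hp₁ : q₁.Prime) (hp₂ : q₂.Prime) (hne : q₁ ≠ q₂)
    (h₁ : q₁ % 8 = 3) (h₂ : q₂ % 8 = 3) : Squarefree (2 * q₁ * q₂) := by
  rw [mul_assoc]
  refine (Nat.squarefree_mul ?_).2 ⟨Nat.prime_two.squarefree, squarefree_mul_of_prime hp₁ hp₂ hne⟩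
  rw [Nat.coprime_two_left, Nat.odd_iff, Nat.mul_mod]
  have : q₁ % 2 = 1 := by omega
  have : q₂ % 2 = 1 := by omega
  simp [*]

theorem not_isSquare_two_mul_mul (hp₁ : q₁.Prime) (hp₂ : q₂.Prime) (hne : q₁ ≠ q₂)
    (h₁ : q₁ % 8 = 3) (h₂ : q₂ % 8 = 3) : ¬ IsSquare (2 * q₁ * q₂) := by
  have := (squarefree_two_mul_mul_of_prime hp₁ hp₂ hne h₁ h₂)
  rintro ⟨r, hr⟩
  have h1 := Nat.isUnit_iff.1 (this r ⟨1, by rw [hr]; ring⟩)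
  subst h1
  have := congrArg (· % 2) hr
  simp [mul_assoc] at this

theorem mul_mod_eight (h₁ : q₁ % 8 = 3) (h₂ : q₂ % 8 = 3) : (q₁ * q₂) % 8 = 1 := by
  rw [Nat.mul_mod, h₁, h₂]

theorem two_mul_mul_mod_eight (h₁ : q₁ % 8 = 3) (h₂ : q₂ % 8 = 3) : (2 * q₁ * q₂) % 8 = 2 := by
  rw [mul_assoc, Nat.mul_mod, Nat.mul_mod q₁, h₁, h₂]

/-- Among the splittings ab = q₁q₂, b = 1 is excluded by minimality and a = 1 because q₁ would
divide u² + 1. Hence {a, b} = {q₁, q₂}. -/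
theorem exists_sqrt_fundamentalUnit_mul (hp₁ : q₁.Prime) (hp₂ : q₂.Prime) (hne : q₁ ≠ q₂)
    (h₁ : q₁ % 8 = 3) (h₂ : q₂ % 8 = 3) :
    ∃ u v : ℤ, √(fundamentalUnit (q₁ * q₂)) = u * √q₁ + v * √q₂ := by
  have hsq := not_isSquare_mul_of_prime hp₁ hp₂ hne
  obtain ⟨x, y, hxy, hn, hx, hy⟩ := (isQuadraticUnit_fundamentalUnit hsq).exists_int
    (squarefree_mul_of_prime hp₁ hp₂ hne) hsq (Or.inl (mul_mod_eight h₁ h₂)) hp₁ (by omega)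
    (dvd_mul_right _ _)
  obtain ⟨a, b, u, v, hab, huv, hb, hε⟩ := exists_sqrt_fundamentalUnit hsq hxy hn hx hy
  rcases eq_mul_or_eq_mul_of_mul_eq hp₁ hab with ⟨c, rfl, hc⟩ | ⟨c, rfl, hc⟩
  · rcases eq_mul_or_eq_mul_of_mul_eq hp₂ (hc.trans (mul_one _).symm) with ⟨e, rfl, he⟩ | ⟨e, rfl, he⟩
    · exact absurd (mul_eq_one.1 he).2 hb
    · obtain ⟨rfl, rfl⟩ := mul_eq_one.1 he
      refine ⟨u, v, ?_⟩
      rw [hε]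
      push_cast
      simp only [mul_one]
      ring
  · rcases eq_mul_or_eq_mul_of_mul_eq hp₂ (hc.trans (mul_one _).symm) with ⟨e, rfl, he⟩ | ⟨e, rfl, he⟩
    · obtain ⟨rfl, rfl⟩ := mul_eq_one.1 he
      refine ⟨v, u, ?_⟩
      rw [hε]
      push_cast
      simp only [mul_one]
    · obtain ⟨rfl, rfl⟩ := mul_eq_one.1 he
      exfalso
      apply hp₁.not_dvd_sq_add_one (by omega) u
      refine ⟨q₂ * v ^ 2, ?_⟩
      have : (u ^ 2 + 1 : ℕ) = q₁ * (q₂ * v ^ 2) := by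
        linear_combination -huv
      exact_mod_cast this

/-- The cases a = 1 and b = 1 fail as for q₁q₂, and separating q₁ from q₂ fails mod 8. What is left
is {a, b} = {2, q₁q₂}, the sign recording which is which. -/
theorem exists_sqrt_fundamentalUnit_two_mul_mul (hp₁ : q₁.Prime) (hp₂ : q₂.Prime) (hne : q₁ ≠ q₂)
    (h₁ : q₁ % 8 = 3) (h₂ : q₂ % 8 = 3) :
    ∃ u v : ℤ, √(fundamentalUnit (2 * q₁ * q₂)) = u * √2 + v * √(q₁ * q₂ : ℕ) ∧
      (2 * u ^ 2 - (q₁ * q₂ : ℕ) * v ^ 2 = 1 ∨ 2 * u ^ 2 - (q₁ * q₂ : ℕ) * v ^ 2 = -1) := by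
  have hsq := not_isSquare_two_mul_mul hp₁ hp₂ hne h₁ h₂
  obtain ⟨x, y, hxy, hn, hx, hy⟩ := (isQuadraticUnit_fundamentalUnit hsq).exists_int
    (squarefree_two_mul_mul_of_prime hp₁ hp₂ hne h₁ h₂) hsq
    (Or.inr (two_mul_mul_mod_eight h₁ h₂)) hp₁ (by omega)
    ⟨2 * q₂, by ring⟩
  obtain ⟨a, b, u, v, hab, huv, hb, hε⟩ := exists_sqrt_fundamentalUnit hsq hxy hn hx hy
  have e₁ : (q₁ : ZMod 8) = 3 := by exact_mod_cast (ZMod.natCast_eq_natCast_iff' q₁ 3 8).2 h₁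
  have e₂ : (q₂ : ZMod 8) = 3 := by exact_mod_cast (ZMod.natCast_eq_natCast_iff' q₂ 3 8).2 h₂
  have h8 := congrArg (Nat.cast : ℕ → ZMod 8) huv
  -- These are bv² = au² + 1 for (a, b) = (qᵢ, 2qⱼ) and (2qᵢ, qⱼ), reduced by qᵢ ≡ qⱼ ≡ 3.
  have hc1 : ∀ s t : ZMod 8, 2 * 3 * s ^ 2 ≠ 3 * t ^ 2 + 1 := by decide
  have hc2 : ∀ s t : ZMod 8, 3 * s ^ 2 ≠ 2 * 3 * t ^ 2 + 1 := by decide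
  rw [mul_assoc] at hab
  rcases eq_mul_or_eq_mul_of_mul_eq Nat.prime_two hab with ⟨c, rfl, hc⟩ | ⟨c, rfl, hc⟩ <;>
  rcases eq_mul_or_eq_mul_of_mul_eq hp₁ hc with ⟨e, rfl, he⟩ | ⟨e, rfl, he⟩ <;>
  rcases eq_mul_or_eq_mul_of_mul_eq hp₂ (he.trans (mul_one _).symm) with
    ⟨f, rfl, hf⟩ | ⟨f, rfl, hf⟩ <;> obtain ⟨rfl, rfl⟩ := mul_eq_one.1 hf <;>
  push_cast [e₁, e₂] at h8 <;> simp only [mul_one] at *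
  · exact absurd rfl hb
  · exact absurd h8 (hc2 _ _)
  · exact absurd h8 (hc2 _ _)
  · refine ⟨u, v, by rw [hε]; push_cast; ring, Or.inr ?_⟩
    have : ((q₁ * q₂ : ℕ) : ℤ) * v ^ 2 = 2 * u ^ 2 + 1 := by exact_mod_cast huv
    linarith
  · refine ⟨v, u, by rw [hε]; push_cast; ring, Or.inl ?_⟩
    have : 2 * (v : ℤ) ^ 2 = ((q₁ * q₂ : ℕ) : ℤ) * u ^ 2 + 1 := by exact_mod_cast huv
    linarith
  · exact absurd h8 (hc1 _ _)
  · exact absurd h8 (hc1 _ _)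
  · exfalso
    apply hp₁.not_dvd_sq_add_one (by omega) u
    refine ⟨2 * q₂ * v ^ 2, ?_⟩
    have : (u ^ 2 + 1 : ℕ) = q₁ * (2 * q₂ * v ^ 2) := by
      linear_combination -huv
    exact_mod_cast this

end primes

/-! ### The field ℚ(√2, √d) and its real embeddings -/

/-- The ring `ℚ[X, Y] / (X² - 2, Y² - d)`. -/
abbrev BiquadraticAlgebra (d : ℕ) : Type :=
  QuadraticAlgebra (QuadraticAlgebra ℚ ((2 : ℕ) : ℚ) 0) (d : QuadraticAlgebra ℚ ((2 : ℕ) : ℚ) 0) 0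

/-- Evaluation at square roots `s` of `2` and `t` of `d`. -/
noncomputable def biquadraticEval (d : ℕ) (s t : ℝ) (hs : s ^ 2 = (2 : ℕ)) (ht : t ^ 2 = d) :
    BiquadraticAlgebra d →+* ℝ where
  toFun z := quadraticEval 2 s hs z.re + quadraticEval 2 s hs z.im * t
  map_zero' := by simp
  map_one' := by
    have h1 : (1 : BiquadraticAlgebra d).re = 1 := rfl
    have h2 : (1 : BiquadraticAlgebra d).im = 0 := rfl
    rw [h1, h2]
    simp
  map_add' z w := by
    rw [QuadraticAlgebra.re_add, QuadraticAlgebra.im_add, map_add, map_add]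
    ring
  map_mul' z w := by
    rw [QuadraticAlgebra.re_mul, QuadraticAlgebra.im_mul]
    simp only [map_add, map_mul, map_natCast, zero_mul, map_zero]
    linear_combination (-quadraticEval 2 s hs z.im * quadraticEval 2 s hs w.im) * ht

theorem biquadraticEval_apply (d : ℕ) (s t : ℝ) (hs : s ^ 2 = (2 : ℕ)) (ht : t ^ 2 = d)
    (z : BiquadraticAlgebra d) : biquadraticEval d s t hs ht z =
      z.re.re + z.re.im * s + (z.im.re + z.im.im * s) * t := rfl

theorem not_isSquare_two : ¬ IsSquare (2 : ℕ) := by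
  simpa using Nat.prime_two.not_isSquare_mul (m := 1) (by norm_num)

/-- The content is that d is not a square in ℚ(√2): a square root there would be rational or a
rational multiple of √2, making d or 2d a square. -/
theorem biquadraticEval_injective {d : ℕ} (hd : ¬ IsSquare d) (h2d : ¬ IsSquare (2 * d)) {s t : ℝ}
    (hs : s ^ 2 = (2 : ℕ)) (ht : t ^ 2 = d) :
    Function.Injective (biquadraticEval d s t hs ht) := by
  rw [injective_iff_map_eq_zero]
  rintro ⟨⟨a, b⟩, ⟨c, e⟩⟩ hz
  have hz' : quadraticEval 2 s hs ⟨a, b⟩ + quadraticEval 2 s hs ⟨c, e⟩ * t = 0 := hz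
  have hsq : (⟨a, b⟩ : QuadraticAlgebra ℚ ((2 : ℕ) : ℚ) 0) * ⟨a, b⟩ = d * (⟨c, e⟩ * ⟨c, e⟩) := by
    apply quadraticEval_injective not_isSquare_two hs
    simp only [map_mul, map_natCast]
    linear_combination (quadraticEval 2 s hs ⟨a, b⟩ - quadraticEval 2 s hs ⟨c, e⟩ * t) * hz' +
      quadraticEval 2 s hs ⟨c, e⟩ ^ 2 * ht
  have E1 : a ^ 2 + 2 * b ^ 2 = d * (c ^ 2 + 2 * e ^ 2) := by
    have := congrArg QuadraticAlgebra.re hsq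
    simp at this
    linarith
  have E2 : a * b = d * (c * e) := by
    have := congrArg QuadraticAlgebra.im hsq
    simp at this
    linarith
  -- `F1` and `F2` are the rational part and the √2 part of ((a + b√2)/(c + e√2))² = d, with
  -- denominators cleared.
  have F1 : (a * c - 2 * b * e) ^ 2 + 2 * (b * c - a * e) ^ 2 = d * (c ^ 2 - 2 * e ^ 2) ^ 2 := by
    linear_combination (c ^ 2 + 2 * e ^ 2) * E1 - 8 * c * e * E2
  have F2 : (a * c - 2 * b * e) * (b * c - a * e) = 0 := by
    linear_combination (c ^ 2 + 2 * e ^ 2) * E2 - c * e * E1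
  have hn : c ^ 2 - 2 * e ^ 2 = 0 := by
    by_contra hn
    rcases mul_eq_zero.1 F2 with h | h
    · apply rat_sq_ne_natCast h2d (2 * (b * c - a * e) / (c ^ 2 - 2 * e ^ 2))
      rw [h] at F1
      rw [div_pow, div_eq_iff (pow_ne_zero 2 hn)]
      push_cast
      linarith
    · apply rat_sq_ne_natCast hd ((a * c - 2 * b * e) / (c ^ 2 - 2 * e ^ 2))
      rw [h] at F1
      rw [div_pow, div_eq_iff (pow_ne_zero 2 hn)]
      linarith
  have he : e = 0 := by
    by_contra he
    apply rat_sq_ne_natCast not_isSquare_two (c / e)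
    rw [div_pow, div_eq_iff (pow_ne_zero 2 he)]
    push_cast
    linarith
  subst he
  have hc : c = 0 := by simpa using hn
  subst hc
  have hb : b = 0 := by nlinarith [sq_nonneg a, sq_nonneg b]
  subst hb
  have ha : a = 0 := by simpa using E1
  subst ha
  rfl

theorem sqrt_two_sq : (√2 : ℝ) ^ 2 = (2 : ℕ) := by norm_num

theorem neg_sqrt_two_sq : (-√2 : ℝ) ^ 2 = (2 : ℕ) := by norm_num

/-- The embedding of `ℚ[X, Y] / (X² - 2, Y² - d)` in `ℝ` with `X ↦ √2`, `Y ↦ √d`. -/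
noncomputable abbrev embPP (d : ℕ) : BiquadraticAlgebra d →+* ℝ :=
  biquadraticEval d √2 √d sqrt_two_sq (sq_sqrt_natCast d)

/-- The embedding of `ℚ[X, Y] / (X² - 2, Y² - d)` in `ℝ` with `X ↦ -√2`, `Y ↦ √d`. -/
noncomputable abbrev embNP (d : ℕ) : BiquadraticAlgebra d →+* ℝ :=
  biquadraticEval d (-√2) √d neg_sqrt_two_sq (sq_sqrt_natCast d)

/-- The embedding of `ℚ[X, Y] / (X² - 2, Y² - d)` in `ℝ` with `X ↦ √2`, `Y ↦ -√d`. -/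
noncomputable abbrev embPN (d : ℕ) : BiquadraticAlgebra d →+* ℝ :=
  biquadraticEval d √2 (-√d) sqrt_two_sq (neg_sqrt_sq_natCast d)

/-- The ring (in fact field) `ℚ(√2, √d) ⊂ ℝ`. -/
noncomputable def realBiquadratic (d : ℕ) : Subring ℝ := (embPP d).range

theorem mem_realBiquadratic_iff {d : ℕ} {x : ℝ} : x ∈ realBiquadratic d ↔
    ∃ a b c e : ℚ, x = a + b * √2 + (c + e * √2) * √d := by
  constructor
  · rintro ⟨r, rfl⟩
    exact ⟨_, _, _, _, biquadraticEval_apply ..⟩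
  · rintro ⟨a, b, c, e, rfl⟩
    exact ⟨⟨⟨a, b⟩, ⟨c, e⟩⟩, biquadraticEval_apply ..⟩

theorem ratCast_mem_realBiquadratic (d : ℕ) (q : ℚ) : (q : ℝ) ∈ realBiquadratic d :=
  mem_realBiquadratic_iff.2 ⟨q, 0, 0, 0, by simp⟩

theorem sqrt_two_mem_realBiquadratic (d : ℕ) : √2 ∈ realBiquadratic d :=
  mem_realBiquadratic_iff.2 ⟨0, 1, 0, 0, by simp⟩

theorem sqrt_mem_realBiquadratic (d : ℕ) : √d ∈ realBiquadratic d :=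
  mem_realBiquadratic_iff.2 ⟨0, 0, 1, 0, by simp⟩

theorem sqrt_two_mul_eq (d : ℕ) : √((2 * d : ℕ) : ℝ) = √2 * √d := by
  push_cast
  rw [Real.sqrt_mul (by norm_num)]

/-- In this and the next two products, the automorphism exchanging the two embeddings fixes √d, √2
and √(2d) respectively, so the product lies in that quadratic field. -/
theorem embPP_mul_embNP (d : ℕ) (r : BiquadraticAlgebra d) :
    ∃ a b : ℚ, embPP d r * embNP d r = a + b * √d := by
  refine ⟨r.re.re ^ 2 + d * r.im.re ^ 2 - 2 * r.re.im ^ 2 - 2 * d * r.im.im ^ 2,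
    2 * r.re.re * r.im.re - 4 * r.re.im * r.im.im, ?_⟩
  simp only [embPP, embNP, biquadraticEval_apply]
  have h := sqrt_two_sq
  push_cast at h ⊢
  linear_combination ((r.im.re : ℝ) ^ 2 - √2 ^ 2 * r.im.im ^ 2) * sq_sqrt_natCast d -
    (r.re.im ^ 2 + 2 * r.re.im * r.im.im * √d + d * r.im.im ^ 2) * h

theorem embPP_mul_embPN (d : ℕ) (r : BiquadraticAlgebra d) :
    ∃ a b : ℚ, embPP d r * embPN d r = a + b * √2 := by
  refine ⟨r.re.re ^ 2 + 2 * r.re.im ^ 2 - d * r.im.re ^ 2 - 2 * d * r.im.im ^ 2,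
    2 * r.re.re * r.re.im - 2 * d * r.im.re * r.im.im, ?_⟩
  simp only [embPP, embPN, biquadraticEval_apply]
  have h := sqrt_two_sq
  push_cast at h ⊢
  linear_combination (-((r.im.re : ℝ) + r.im.im * √2) ^ 2) * sq_sqrt_natCast d +
    (r.re.im ^ 2 - d * r.im.im ^ 2) * h

theorem embNP_mul_embPN (d : ℕ) (r : BiquadraticAlgebra d) :
    ∃ a b : ℚ, embNP d r * embPN d r = a + b * √((2 * d : ℕ) : ℝ) := by
  refine ⟨r.re.re ^ 2 + 2 * d * r.im.im ^ 2 - 2 * r.re.im ^ 2 - d * r.im.re ^ 2,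
    2 * r.re.im * r.im.re - 2 * r.re.re * r.im.im, ?_⟩
  rw [sqrt_two_mul_eq]
  simp only [embNP, embPN, biquadraticEval_apply]
  have h := sqrt_two_sq
  push_cast at h ⊢
  linear_combination ((r.im.im : ℝ) ^ 2 * √2 ^ 2 - r.im.re ^ 2) * sq_sqrt_natCast d +
    (d * r.im.im ^ 2 - r.re.im ^ 2) * h

/-- The three irrational coefficients of y² vanish, which leaves at most one nonzero coordinate.
This serves both to keep square roots of other primes out of K and to list its quadratic subfields.
-/
theorem eq_or_of_sq_eq_ratCast {d : ℕ} (hd : ¬ IsSquare d) (h2d : ¬ IsSquare (2 * d)) {y : ℝ}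
    (hy : y ∈ realBiquadratic d) {n : ℚ} (hn : y ^ 2 = n) :
    ∃ a : ℚ, y = a ∨ y = a * √2 ∨ y = a * √d ∨ y = a * √((2 * d : ℕ) : ℝ) := by
  obtain ⟨⟨⟨a, b⟩, ⟨c, e⟩⟩, rfl⟩ := hy
  have hr : (⟨⟨a, b⟩, ⟨c, e⟩⟩ : BiquadraticAlgebra d) * ⟨⟨a, b⟩, ⟨c, e⟩⟩ = ⟨⟨n, 0⟩, 0⟩ := by
    apply biquadraticEval_injective hd h2d sqrt_two_sq (sq_sqrt_natCast d)
    rw [map_mul, ← sq]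
    refine hn.trans ?_
    rw [biquadraticEval_apply]
    simp
  have h1 := congrArg (fun z => z.re.im) hr
  have h2 := congrArg (fun z => z.im.re) hr
  have h3 := congrArg (fun z => z.im.im) hr
  simp at h1 h2 h3
  have g1 : a * b = -(d * (c * e)) := by linarith
  have g2 : a * c = -(2 * (b * e)) := by linarith
  have g3 : a * e = -(b * c) := by linarith
  have hbc : b * c = 0 := by
    by_contra hbc
    have hb : b ≠ 0 := left_ne_zero_of_mul hbc
    have hc : c ≠ 0 := right_ne_zero_of_mul hbc
    have ha : a ^ 2 = 2 * d * e ^ 2 := by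
      apply mul_left_cancel₀ hbc
      linear_combination a * c * g1 - d * c * e * g2
    by_cases he : e = 0
    · subst he
      simp at g3
      tauto
    · apply rat_sq_ne_natCast h2d (a / e)
      rw [div_pow, div_eq_iff (pow_ne_zero 2 he), ha]
      push_cast
      ring
  have hd0 : (d : ℚ) ≠ 0 := by
    rintro h
    apply hd
    have : d = 0 := by exact_mod_cast h
    rw [this]
    exact IsSquare.zero
  rw [hbc, neg_zero] at g3
  rw [embPP, biquadraticEval_apply, sqrt_two_mul_eq]
  simp only
  by_cases ha : a = 0
  · subst ha
    by_cases hb : b = 0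
    · subst hb
      have hce : c * e = 0 := by simpa [hd0] using g1
      rcases mul_eq_zero.1 hce with rfl | rfl
      · exact ⟨e, by simp [mul_assoc]⟩
      · exact ⟨c, by simp⟩
    · have hc : c = 0 := by simpa [hb] using hbc
      have he : e = 0 := by simpa [hb] using g2
      subst hc he
      exact ⟨b, by simp⟩
  · have he : e = 0 := by simpa [ha] using g3
    subst he
    have hb : b = 0 := by simpa [ha] using g1
    have hc : c = 0 := by simpa [ha] using g2
    subst hb hc
    exact ⟨a, by simp⟩

theorem BiquadraticAlgebra.eq_one {d : ℕ} {r : BiquadraticAlgebra d} (h1 : r.re.re = 1)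
    (h2 : r.re.im = 0) (h3 : r.im.re = 0) (h4 : r.im.im = 0) : r = 1 := by
  ext
  · exact h1
  · exact h2
  · exact h3
  · exact h4

theorem map_units_zpow {d : ℕ} (f : BiquadraticAlgebra d →+* ℝ) (r : (BiquadraticAlgebra d)ˣ)
    (n : ℤ) : f ↑(r ^ n) = f r ^ n := by
  have := congrArg Units.val (map_zpow (Units.map (f : BiquadraticAlgebra d →* ℝ)) r n)
  rw [Units.val_zpow_eq_zpow_val] at this
  exact this

/-! ### Units of ℚ(√2, √d) -/

/-- The arithmetic of the quadratic subfields of `ℚ(√2, √d)` that determines its units. -/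
structure BiquadraticUnitData (d : ℕ) : Prop where
  squarefree : Squarefree d
  odd : Odd d
  not_isSquare : ¬ IsSquare d
  not_isSquare_two_mul : ¬ IsSquare (2 * d)
  exists_int {x : ℝ} : IsQuadraticUnit d x →
    ∃ a b : ℤ, x = a + b * √d ∧ a ^ 2 - d * b ^ 2 = 1 ∧ Odd a ∧ Even b
  exists_sqrt : ∃ u v : ℤ, √(fundamentalUnit (2 * d)) = u * √2 + v * √d ∧
    (2 * u ^ 2 - d * v ^ 2 = 1 ∨ 2 * u ^ 2 - d * v ^ 2 = -1)
  sqrt_notMem : √(fundamentalUnit d) ∉ realBiquadratic d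
  -- This keeps √-3, hence the primitive cube roots of unity, out of L_d.
  sq_ne_three {y : ℝ} : y ∈ realBiquadratic d → y ^ 2 ≠ 3

namespace BiquadraticUnitData

variable {d : ℕ}

theorem embPP_injective (D : BiquadraticUnitData d) : Function.Injective (embPP d) :=
  biquadraticEval_injective D.not_isSquare D.not_isSquare_two_mul _ _

theorem fundamentalUnit_two_pos : 0 < fundamentalUnit 2 :=
  one_pos.trans (one_lt_fundamentalUnit not_isSquare_two)

theorem fundamentalUnit_pos (D : BiquadraticUnitData d) : 0 < fundamentalUnit d :=
  one_pos.trans (one_lt_fundamentalUnit D.not_isSquare)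

theorem fundamentalUnit_two_mul_pos (D : BiquadraticUnitData d) : 0 < fundamentalUnit (2 * d) :=
  one_pos.trans (one_lt_fundamentalUnit D.not_isSquare_two_mul)

theorem sqrt_fundamentalUnit_pos (D : BiquadraticUnitData d) : 0 < √(fundamentalUnit (2 * d)) :=
  Real.sqrt_pos.2 D.fundamentalUnit_two_mul_pos

/-- `ε₂` and its conjugates. -/
theorem exists_emb_fundamentalUnit_two (d : ℕ) : ∃ r : (BiquadraticAlgebra d)ˣ,
    embPP d r = fundamentalUnit 2 ∧ embNP d r = -(fundamentalUnit 2)⁻¹ ∧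
    embPN d r = fundamentalUnit 2 := by
  obtain ⟨a, b, hab, hN⟩ := exists_norm_fundamentalUnit_two
  have hN' : (a : ℝ) ^ 2 - 2 * b ^ 2 = -1 := by exact_mod_cast hN
  have h := sqrt_two_sq
  push_cast at h
  have e1 : (⟨⟨a, b⟩, 0⟩ : BiquadraticAlgebra d) * ⟨⟨-a, b⟩, 0⟩ = 1 := by
    apply BiquadraticAlgebra.eq_one
    · simp; linarith
    · simp; ring
    · simp
    · simp
  refine ⟨⟨⟨⟨a, b⟩, 0⟩, ⟨⟨-a, b⟩, 0⟩, e1, by rw [mul_comm]; exact e1⟩, ?_, ?_, ?_⟩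
  · rw [biquadraticEval_apply, hab]; simp
  · rw [hab, ← inv_neg, biquadraticEval_apply]
    apply eq_inv_of_mul_eq_one_left
    simp
    linear_combination (b : ℝ) ^ 2 * h - hN'
  · rw [biquadraticEval_apply, hab]; simp

/-- `ε_d` and its conjugates. -/
theorem exists_emb_fundamentalUnit (D : BiquadraticUnitData d) : ∃ r : (BiquadraticAlgebra d)ˣ,
    embPP d r = fundamentalUnit d ∧ embNP d r = fundamentalUnit d ∧
    embPN d r = (fundamentalUnit d)⁻¹ := by
  obtain ⟨a, b, hab, hN, -, -⟩ :=
    D.exists_int (isQuadraticUnit_fundamentalUnit D.not_isSquare)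
  have hN' : (a : ℝ) ^ 2 - d * b ^ 2 = 1 := by exact_mod_cast hN
  have hN'' : (a : ℚ) ^ 2 - d * b ^ 2 = 1 := by exact_mod_cast hN
  have h := sq_sqrt_natCast d
  have e1 : (⟨⟨a, 0⟩, ⟨b, 0⟩⟩ : BiquadraticAlgebra d) * ⟨⟨a, 0⟩, ⟨-b, 0⟩⟩ = 1 := by
    apply BiquadraticAlgebra.eq_one
    · simp; linarith
    · simp
    · simp; ring
    · simp
  refine ⟨⟨⟨⟨a, 0⟩, ⟨b, 0⟩⟩, ⟨⟨a, 0⟩, ⟨-b, 0⟩⟩, e1, by rw [mul_comm]; exact e1⟩, ?_, ?_, ?_⟩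
  · rw [biquadraticEval_apply, hab]; simp
  · rw [biquadraticEval_apply, hab]; simp
  · rw [hab, biquadraticEval_apply]
    apply eq_inv_of_mul_eq_one_left
    simp
    linear_combination (-(b : ℝ) ^ 2) * h + hN'

/-- `√ε_{2d}` and its conjugates. -/
theorem exists_emb_sqrt_fundamentalUnit (D : BiquadraticUnitData d) :
    ∃ r : (BiquadraticAlgebra d)ˣ, ∃ δ : ℝ, (δ = 1 ∨ δ = -1) ∧
      embPP d r = √(fundamentalUnit (2 * d)) ∧
      embNP d r = -δ * (√(fundamentalUnit (2 * d)))⁻¹ ∧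
      embPN d r = δ * (√(fundamentalUnit (2 * d)))⁻¹ := by
  obtain ⟨u, v, huv, hδ⟩ := D.exists_sqrt
  obtain ⟨δ, hδ1, hδ2⟩ : ∃ δ : ℤ, (δ = 1 ∨ δ = -1) ∧ 2 * u ^ 2 - d * v ^ 2 = δ := ⟨_, hδ, rfl⟩
  have hN : (2 : ℝ) * u ^ 2 - d * v ^ 2 = δ := by exact_mod_cast hδ2
  have hN' : (2 : ℚ) * u ^ 2 - d * v ^ 2 = δ := by exact_mod_cast hδ2
  have hδδ : (δ : ℚ) * δ = 1 := by
    rcases hδ1 with rfl | rfl <;> norm_num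
  have h := sq_sqrt_natCast d
  have h' := sqrt_two_sq
  push_cast at h'
  have e1 : (⟨⟨0, u⟩, ⟨v, 0⟩⟩ : BiquadraticAlgebra d) * ⟨⟨0, δ * u⟩, ⟨-δ * v, 0⟩⟩ = 1 := by
    apply BiquadraticAlgebra.eq_one
    · simp; linear_combination δ * hN' + hδδ
    · simp
    · simp
    · simp; ring
  have hpos := D.sqrt_fundamentalUnit_pos
  refine ⟨⟨⟨⟨0, u⟩, ⟨v, 0⟩⟩, ⟨⟨0, δ * u⟩, ⟨-δ * v, 0⟩⟩, e1, by rw [mul_comm]; exact e1⟩, δ,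
    by exact_mod_cast hδ1, ?_, ?_, ?_⟩
  · rw [biquadraticEval_apply, huv]; simp
  · rw [eq_mul_inv_iff_mul_eq₀ hpos.ne', huv, biquadraticEval_apply]
    simp
    linear_combination (-(u : ℝ) ^ 2) * h' + (v : ℝ) ^ 2 * h - hN
  · rw [eq_mul_inv_iff_mul_eq₀ hpos.ne', huv, biquadraticEval_apply]
    simp
    linear_combination ((u : ℝ) ^ 2) * h' - (v : ℝ) ^ 2 * h + hN

theorem isIntegral_emb (D : BiquadraticUnitData d) {r : BiquadraticAlgebra d}
    (h : IsIntegral ℤ (embPP d r)) : IsIntegral ℤ (embNP d r) ∧ IsIntegral ℤ (embPN d r) :=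
  ⟨h.map_of_injective _ _ D.embPP_injective, h.map_of_injective _ _ D.embPP_injective⟩

theorem exists_emb_unit (D : BiquadraticUnitData d) {x : ℝ} (hx0 : x ≠ 0)
    (hx : x ∈ realBiquadratic d) (hx' : x⁻¹ ∈ realBiquadratic d) :
    ∃ r : (BiquadraticAlgebra d)ˣ, embPP d r = x ∧ embPP d ↑r⁻¹ = x⁻¹ := by
  obtain ⟨r, rfl⟩ := hx
  obtain ⟨r', hr'⟩ := hx'
  have h1 : r * r' = 1 := by
    apply D.embPP_injective
    rw [map_mul, hr', map_one, mul_inv_cancel₀ hx0]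
  exact ⟨⟨r, r', h1, by rw [mul_comm]; exact h1⟩, rfl, hr'⟩

/-- The relative norms of a unit of `ℚ(√2, √d)` to the three quadratic subfields. -/
theorem isQuadraticUnit_norms (D : BiquadraticUnitData d) (r : (BiquadraticAlgebra d)ˣ)
    (hi : IsIntegral ℤ (embPP d r)) (hi' : IsIntegral ℤ (embPP d ↑r⁻¹)) :
    IsQuadraticUnit d (embPP d r * embNP d r) ∧ IsQuadraticUnit 2 (embPP d r * embPN d r) ∧
      IsQuadraticUnit (2 * d) (embNP d r * embPN d r) := by
  have h1 := D.isIntegral_emb hi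
  have h2 := D.isIntegral_emb hi'
  have key (f : BiquadraticAlgebra d →+* ℝ) : f r ≠ 0 ∧ (f r)⁻¹ = f ↑r⁻¹ := by
    have : f r * f ↑r⁻¹ = 1 := by rw [← map_mul, Units.mul_inv, map_one]
    exact ⟨left_ne_zero_of_mul_eq_one this, inv_eq_of_mul_eq_one_right this⟩
  obtain ⟨n1, i1⟩ := key (embPP d)
  obtain ⟨n2, i2⟩ := key (embNP d)
  obtain ⟨n3, i3⟩ := key (embPN d)
  refine ⟨⟨mul_ne_zero n1 n2, hi.mul h1.1, ?_, embPP_mul_embNP d r⟩,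
    ⟨mul_ne_zero n1 n3, hi.mul h1.2, ?_, by simpa using embPP_mul_embPN d r⟩,
    ⟨mul_ne_zero n2 n3, h1.1.mul h1.2, ?_, embNP_mul_embPN d r⟩⟩
  · rw [mul_inv, i1, i2]; exact hi'.mul h2.1
  · rw [mul_inv, i1, i3]; exact hi'.mul h2.2
  · rw [mul_inv, i2, i3]; exact h2.1.mul h2.2

/-- From x² · (x'x'') = (xx')(xx''), where each product is ± a power of a fundamental unit; absolute
values remove the signs. -/
theorem sq_eq_of_unit (D : BiquadraticUnitData d) {x : ℝ} (hx0 : 0 < x)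
    (hx : x ∈ realBiquadratic d) (hx' : x⁻¹ ∈ realBiquadratic d)
    (hi : IsIntegral ℤ x) (hi' : IsIntegral ℤ x⁻¹) :
    ∃ a b c : ℤ, x ^ 2 = fundamentalUnit 2 ^ a * fundamentalUnit d ^ b *
      fundamentalUnit (2 * d) ^ c := by
  obtain ⟨r, hr, hr'⟩ := D.exists_emb_unit hx0.ne' hx hx'
  rw [← hr] at hi
  rw [← hr'] at hi'
  obtain ⟨h1, h2, h3⟩ := D.isQuadraticUnit_norms r hi hi'
  obtain ⟨b, hb⟩ := h1.exists_zpow D.not_isSquare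
  obtain ⟨a, ha⟩ := h2.exists_zpow not_isSquare_two
  obtain ⟨c, hc⟩ := h3.exists_zpow D.not_isSquare_two_mul
  have e1 : 0 < fundamentalUnit 2 ^ a := zpow_pos fundamentalUnit_two_pos a
  have e2 : 0 < fundamentalUnit d ^ b := zpow_pos D.fundamentalUnit_pos b
  have e3 : 0 < fundamentalUnit (2 * d) ^ c := zpow_pos D.fundamentalUnit_two_mul_pos c
  have hne : embNP d r * embPN d r ≠ 0 := h3.1
  have key : x ^ 2 * (embNP d r * embPN d r) =
      (embPP d r * embNP d r) * (embPP d r * embPN d r) := by rw [← hr]; ring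
  refine ⟨a, b, -c, ?_⟩
  rw [zpow_neg, eq_mul_inv_iff_mul_eq₀ e3.ne']
  rw [← abs_of_pos (mul_pos (pow_pos hx0 2) e3), ← abs_of_pos (mul_pos e1 e2)]
  have a1 : |embPP d r * embNP d r| = fundamentalUnit d ^ b := by
    rcases hb with h | h <;> rw [h] <;> simp [abs_of_pos D.fundamentalUnit_pos]
  have a2 : |embPP d r * embPN d r| = fundamentalUnit 2 ^ a := by
    rcases ha with h | h <;> rw [h] <;> simp [abs_of_pos fundamentalUnit_two_pos]
  have a3 : |embNP d r * embPN d r| = fundamentalUnit (2 * d) ^ c := by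
    rcases hc with h | h <;> rw [h] <;> simp [abs_of_pos D.fundamentalUnit_two_mul_pos]
  have key' := congrArg abs key
  rw [abs_mul, abs_mul (embPP d r * embNP d r), a1, a2, a3] at key'
  rw [abs_mul, abs_mul, abs_of_pos e1, abs_of_pos e2, abs_of_pos e3, key', mul_comm]

theorem fundamentalUnit_two_zpow_mem (d : ℕ) (n : ℤ) :
    fundamentalUnit 2 ^ n ∈ realBiquadratic d := by
  obtain ⟨r, h, -, -⟩ := exists_emb_fundamentalUnit_two d
  exact ⟨↑(r ^ n), by rw [map_units_zpow, h]⟩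

theorem fundamentalUnit_zpow_mem (D : BiquadraticUnitData d) (n : ℤ) :
    fundamentalUnit d ^ n ∈ realBiquadratic d := by
  obtain ⟨r, h, -, -⟩ := D.exists_emb_fundamentalUnit
  exact ⟨↑(r ^ n), by rw [map_units_zpow, h]⟩

theorem sqrt_fundamentalUnit_zpow_mem (D : BiquadraticUnitData d) (n : ℤ) :
    √(fundamentalUnit (2 * d)) ^ n ∈ realBiquadratic d := by
  obtain ⟨r, δ, -, h, -, -⟩ := D.exists_emb_sqrt_fundamentalUnit
  exact ⟨↑(r ^ n), by rw [map_units_zpow, h]⟩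

/-- The positive units of `ℚ(√2, √d)`. -/
theorem exists_zpow_of_unit (D : BiquadraticUnitData d) {x : ℝ} (hx0 : 0 < x)
    (hx : x ∈ realBiquadratic d) (hx' : x⁻¹ ∈ realBiquadratic d)
    (hi : IsIntegral ℤ x) (hi' : IsIntegral ℤ x⁻¹) :
    ∃ a b c : ℤ, x = fundamentalUnit 2 ^ a * fundamentalUnit d ^ b *
      √(fundamentalUnit (2 * d)) ^ c := by
  obtain ⟨a, b, c, habc⟩ := D.sq_eq_of_unit hx0 hx hx' hi hi'
  have p2 := fundamentalUnit_two_pos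
  have pd := D.fundamentalUnit_pos
  have ps := D.sqrt_fundamentalUnit_pos
  have hs : √(fundamentalUnit (2 * d)) ^ 2 = fundamentalUnit (2 * d) :=
    Real.sq_sqrt D.fundamentalUnit_two_mul_pos.le
  have red (e : ℝ) (he : 0 < e) (n : ℤ) : e ^ n = (e ^ (n / 2)) ^ 2 * e ^ (n % 2) := by
    rw [← zpow_natCast, ← zpow_mul, ← zpow_add₀ he.ne']
    congr 1
    push_cast
    omega
  -- Dividing x by known units of K leaves y with exponents 0 or 1 in y². The exponent c disappears
  -- entirely since √ε_{2d} ∈ K.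
  obtain ⟨y, hy⟩ : ∃ y, y = x * (fundamentalUnit 2 ^ (-(a / 2)) * fundamentalUnit d ^ (-(b / 2)) *
    √(fundamentalUnit (2 * d)) ^ (-c)) := ⟨_, rfl⟩
  have hymem : y ∈ realBiquadratic d := by
    rw [hy]
    exact mul_mem hx (mul_mem (mul_mem (fundamentalUnit_two_zpow_mem d _)
      (D.fundamentalUnit_zpow_mem _)) (D.sqrt_fundamentalUnit_zpow_mem _))
  have hy0 : 0 < y := by rw [hy]; positivity
  have hxy : x = y * (fundamentalUnit 2 ^ (a / 2) * fundamentalUnit d ^ (b / 2) *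
      √(fundamentalUnit (2 * d)) ^ c) := by
    rw [hy, zpow_neg, zpow_neg, zpow_neg]
    field_simp
  have hy2 : y ^ 2 = fundamentalUnit 2 ^ (a % 2) * fundamentalUnit d ^ (b % 2) := by
    have hsc : (√(fundamentalUnit (2 * d)) ^ 2) ^ c = (√(fundamentalUnit (2 * d)) ^ c) ^ 2 := by
      rw [← zpow_natCast, ← zpow_natCast, ← zpow_mul, ← zpow_mul, mul_comm c]
    rw [red _ p2 a, red _ pd b, ← hs, hsc, hxy] at habc
    have hpos : 0 < (fundamentalUnit 2 ^ (a / 2) * fundamentalUnit d ^ (b / 2) *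
      √(fundamentalUnit (2 * d)) ^ c) ^ 2 := by positivity
    apply mul_right_cancel₀ hpos.ne'
    linear_combination habc
  obtain ⟨r, rfl⟩ := hymem
  obtain ⟨r2, g1, g2, -⟩ := exists_emb_fundamentalUnit_two d
  obtain ⟨rd, f1, f2, -⟩ := D.exists_emb_fundamentalUnit
  -- Conjugates of squares are squares of reals, whereas √2 ↦ -√2 sends ε₂ and ε₂ε_d to negative
  -- numbers.
  have haux (rr : BiquadraticAlgebra d) (h : embPP d r ^ 2 = embPP d rr) : 0 ≤ embNP d rr := by
    rw [← map_pow] at h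
    rw [← D.embPP_injective h, map_pow]
    exact sq_nonneg _
  rcases Int.emod_two_eq_zero_or_one a with ha | ha <;>
  rcases Int.emod_two_eq_zero_or_one b with hb | hb <;>
  rw [ha, hb] at hy2 <;> simp only [zpow_zero, zpow_one, one_mul, mul_one] at hy2
  · have hy1 : embPP d r = 1 := by
      rwa [pow_eq_one_iff_of_nonneg hy0.le two_ne_zero] at hy2
    exact ⟨_, _, _, by rw [hxy, hy1, one_mul]⟩
  · exfalso
    apply D.sqrt_notMem
    rw [← hy2, Real.sqrt_sq hy0.le]
    exact ⟨r, rfl⟩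
  · exfalso
    have := haux r2 (by rw [hy2, g1])
    rw [g2] at this
    have : 0 < (fundamentalUnit 2)⁻¹ := by positivity
    linarith
  · exfalso
    have := haux (r2 * rd) (by rw [hy2, map_mul, g1, f1])
    rw [map_mul, g2, f2] at this
    have : 0 < (fundamentalUnit 2)⁻¹ * fundamentalUnit d := by positivity
    linarith

/-- `√ε_{2d}` is not in the group generated by `ε₂`, `ε_d` and `ε_{2d}`. -/
theorem sqrt_fundamentalUnit_ne (D : BiquadraticUnitData d) (a b c : ℤ) :
    √(fundamentalUnit (2 * d)) ≠
      fundamentalUnit 2 ^ a * fundamentalUnit d ^ b * fundamentalUnit (2 * d) ^ c := by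
  intro h
  obtain ⟨r2, g1, g2, g3⟩ := exists_emb_fundamentalUnit_two d
  obtain ⟨rd, f1, f2, f3⟩ := D.exists_emb_fundamentalUnit
  obtain ⟨rs, δ, hδ, k1, k2, k3⟩ := D.exists_emb_sqrt_fundamentalUnit
  have p2 := fundamentalUnit_two_pos
  have pd := D.fundamentalUnit_pos
  have ps := D.sqrt_fundamentalUnit_pos
  have hs : √(fundamentalUnit (2 * d)) ^ 2 = fundamentalUnit (2 * d) :=
    Real.sq_sqrt D.fundamentalUnit_two_mul_pos.le
  have hmap (f : BiquadraticAlgebra d →+* ℝ) :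
      f ↑(r2 ^ a * rd ^ b * (rs ^ 2) ^ c) = f r2 ^ a * f rd ^ b * (f rs ^ 2) ^ c := by
    simp only [Units.val_mul, map_mul, map_units_zpow, Units.val_pow_eq_pow_val, map_pow]
  have heq : (rs : BiquadraticAlgebra d) = ↑(r2 ^ a * rd ^ b * (rs ^ 2) ^ c) := by
    apply D.embPP_injective
    rw [hmap, k1, g1, f1, hs]
    exact h
  have hδ2 : δ ^ 2 = 1 := by rcases hδ with rfl | rfl <;> norm_num
  have hPP : embPP d rs = _ := (congrArg (embPP d) heq).trans (hmap _)
  have hPN : embPN d rs = _ := (congrArg (embPN d) heq).trans (hmap _)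
  have hNP : embNP d rs = _ := (congrArg (embNP d) heq).trans (hmap _)
  rw [g1, f1, k1] at hPP
  rw [g3, f3, k3, mul_pow, hδ2, one_mul] at hPN
  rw [g2, f2, k2, mul_pow, neg_sq, hδ2, one_mul] at hNP
  rw [inv_pow, inv_zpow] at hPN hNP
  rw [inv_zpow] at hPN
  generalize √(fundamentalUnit (2 * d)) = s at *
  -- Multiplying the relation by its conjugate under √d ↦ -√d cancels ε_d and ε_{2d}. Hence δ = 1
  -- and a = 0, and then √2 ↦ -√2 equates a negative number with a positive one.
  have e1 : δ = (fundamentalUnit 2 ^ a) ^ 2 := by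
    have : δ = s * (δ * s⁻¹) := by field_simp
    rw [this, hPN]
    nth_rewrite 1 [hPP]
    have : 0 < (s ^ 2) ^ c := by positivity
    field_simp
  have hδ1 : δ = 1 := by
    rcases hδ with h | h
    · exact h
    · rw [h] at e1
      nlinarith [sq_nonneg (fundamentalUnit 2 ^ a)]
  have ha : a = 0 := by
    rw [hδ1, ← zpow_natCast, ← zpow_mul] at e1
    have := (zpow_eq_one_iff_right₀ p2.le (one_lt_fundamentalUnit not_isSquare_two).ne').1 e1.symm
    simpa using this
  rw [hδ1, ha, zpow_zero, one_mul] at hNP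
  have : 0 < s⁻¹ := by positivity
  have : 0 < fundamentalUnit d ^ b * ((s ^ 2) ^ c)⁻¹ := by positivity
  linarith

/-- No unit of `ℚ(√2, √d)` is of the form `√2 r²` with `r` in this field. -/
theorem not_unit_sqrt_two_mul_sq (D : BiquadraticUnitData d) {r x : ℝ}
    (hr : r ∈ realBiquadratic d) (hx0 : x ≠ 0)
    (hx : x ∈ realBiquadratic d) (hx' : x⁻¹ ∈ realBiquadratic d)
    (hi : IsIntegral ℤ x) (hi' : IsIntegral ℤ x⁻¹) : x ≠ √2 * r ^ 2 := by
  intro h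
  obtain ⟨z, hz, hz'⟩ := D.exists_emb_unit hx0 hx hx'
  rw [← hz] at hi
  rw [← hz'] at hi'
  have hunit := (D.isQuadraticUnit_norms z hi hi').1
  obtain ⟨w, rfl⟩ := hr
  have hz2 : (z : BiquadraticAlgebra d) = ⟨⟨0, 1⟩, 0⟩ * w ^ 2 := by
    apply D.embPP_injective
    rw [hz, h, map_mul, map_pow]
    congr 1
    rw [biquadraticEval_apply]
    simp
  have hPP : embPP d z = √2 * embPP d w ^ 2 := by rw [hz, h]
  have hNP : embNP d z = -√2 * embNP d w ^ 2 := by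
    rw [hz2, map_mul, map_pow]
    congr 1
    rw [biquadraticEval_apply]
    simp
  obtain ⟨p, q, hpq⟩ := embPP_mul_embNP d w
  obtain ⟨X, Y, hXY, hN, hX, hY⟩ := D.exists_int hunit
  have hs := sq_sqrt_natCast d
  have h2 := sqrt_two_sq
  push_cast at h2
  -- The norm of √2·w² to ℚ(√d) is -2α² with α = p + q√d the norm of w. It is a unit X + Y√d of norm
  -- 1, so 2(p² - dq²) = ±1.
  have hprod : embPP d z * embNP d z = -2 * ((p : ℝ) + q * √d) ^ 2 := by
    rw [hPP, hNP, ← hpq]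
    linear_combination (-(embPP d w ^ 2 * embNP d w ^ 2)) * h2
  rw [hprod] at hXY
  have hzero := eq_zero_of_add_mul_eq_zero D.not_isSquare hs
    (a := X + 2 * (p ^ 2 + d * q ^ 2)) (b := Y + 4 * p * q) (by
      push_cast
      linear_combination -hXY - 2 * q ^ 2 * hs)
  obtain ⟨z1, z2⟩ := hzero
  have hN' : (X : ℚ) ^ 2 - d * Y ^ 2 = 1 := by exact_mod_cast hN
  have hn4 : (2 * (p ^ 2 - d * q ^ 2)) ^ 2 = 1 := by
    rw [← hN', eq_neg_of_add_eq_zero_left z1, eq_neg_of_add_eq_zero_left z2]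
    ring
  obtain ⟨N, hNodd, hN2⟩ : ∃ N : ℤ, (N = 1 ∨ N = -1) ∧ 2 * (p ^ 2 - d * q ^ 2) = N := by
    rcases mul_self_eq_one_iff.1 ((sq _).symm.trans hn4) with h | h
    · exact ⟨1, by norm_num, by simpa using h⟩
    · exact ⟨-1, by norm_num, by simpa using h⟩
  -- Adding and subtracting 2(p² - dq²) = N and 2(p² + dq²) = -X gives (2p)² = N - X and d(2q)² = -X
  -- - N, so 2p and 2q are integers.
  obtain ⟨P, hP⟩ := exists_int_of_squarefree_mul_sq (D := 1) squarefree_one (r := 2 * p)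
    (n := N - X) (by push_cast; linear_combination hN2 + z1)
  obtain ⟨Q, hQ⟩ := exists_int_of_squarefree_mul_sq D.squarefree (r := 2 * q)
    (n := -X - N) (by push_cast; linear_combination z1 - hN2)
  have hP2 : P ^ 2 = N - X := by
    have : (P : ℚ) ^ 2 = N - X := by rw [← hP]; linear_combination hN2 + z1
    exact_mod_cast this
  have hQ2 : d * Q ^ 2 = -X - N := by
    have : d * (Q : ℚ) ^ 2 = -X - N := by rw [← hQ]; linear_combination z1 - hN2
    exact_mod_cast this
  have hNo : Odd N := by rcases hNodd with rfl | rfl <;> decide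
  -- Since N, X and d are odd, P and Q are even. Then p and q are integers and N = 2(p² - dq²) is
  -- even, a contradiction.
  have hPe : Even P := by
    have : Even (P ^ 2) := by rw [hP2]; exact hNo.sub_odd hX
    exact (Int.even_pow' two_ne_zero).1 this
  have hQe : Even Q := by
    have h1 : Even ((d : ℤ) * Q ^ 2) := by rw [hQ2]; exact hX.neg.sub_odd hNo
    have hd : ¬ Even (d : ℤ) := by
      rw [Int.even_coe_nat]
      exact Nat.not_even_iff_odd.2 D.odd
    exact (Int.even_pow' two_ne_zero).1 ((Int.even_mul.1 h1).resolve_left hd)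
  obtain ⟨P', rfl⟩ := hPe
  obtain ⟨Q', rfl⟩ := hQe
  have h3 : 2 * (P' ^ 2 - d * Q' ^ 2) = N := by
    have : 4 * (2 * (P' ^ 2 - d * Q' ^ 2)) = 4 * N := by linear_combination 2 * hP2 - 2 * hQ2
    linarith
  have : Even N := ⟨P' ^ 2 - d * Q' ^ 2, by rw [← h3]; ring⟩
  exact (Int.not_even_iff_odd.2 hNo) this

end BiquadraticUnitData

/-! ### The field L_d, its embeddings and its roots of unity -/

theorem zetaEight_eq : zetaEight = ((√2 / 2 : ℝ) : ℂ) * (1 + Complex.I) := by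
  have : (2 * Real.pi * Complex.I / 8 : ℂ) = ((Real.pi / 4 : ℝ) : ℂ) * Complex.I := by
    push_cast; ring
  rw [zetaEight, this, Complex.exp_mul_I, ← Complex.ofReal_cos, ← Complex.ofReal_sin,
    Real.cos_pi_div_four, Real.sin_pi_div_four]
  ring

theorem isPrimitiveRoot_zetaEight : IsPrimitiveRoot zetaEight 8 := by
  have := Complex.isPrimitiveRoot_exp 8 (by norm_num)
  simpa [zetaEight] using this

theorem zetaEight_sq : zetaEight ^ 2 = Complex.I := by
  have h : ((√2 : ℝ) : ℂ) ^ 2 = 2 := by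
    rw [← Complex.ofReal_pow, Real.sq_sqrt (by norm_num)]; simp
  rw [zetaEight_eq]
  push_cast
  linear_combination (1 + Complex.I) ^ 2 / 4 * h + Complex.I_sq / 2

theorem zetaEight_ne_zero : zetaEight ≠ 0 := isPrimitiveRoot_zetaEight.ne_zero (by norm_num)

theorem conj_zetaEight : (starRingEnd ℂ) zetaEight = zetaEight⁻¹ := by
  apply eq_inv_of_mul_eq_one_left
  have h : ((√2 : ℝ) : ℂ) ^ 2 = 2 := by
    rw [← Complex.ofReal_pow, Real.sq_sqrt (by norm_num)]; simp
  rw [zetaEight_eq]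
  have h2 : (starRingEnd ℂ) 2 = 2 := map_ofNat _ 2
  simp [h2]
  linear_combination (1 - Complex.I ^ 2) / 4 * h - Complex.I_sq / 2

section fieldL

variable {d : ℕ}

theorem zetaEight_mem_fieldL : zetaEight ∈ fieldL d := subset_adjoin _ _ (by simp)

theorem sqrt_mem_fieldL : ((√d : ℝ) : ℂ) ∈ fieldL d := subset_adjoin _ _ (by simp)

theorem I_mem_fieldL : Complex.I ∈ fieldL d := by
  rw [← zetaEight_sq]
  exact pow_mem zetaEight_mem_fieldL 2

theorem sqrt_two_mem_fieldL : ((√2 : ℝ) : ℂ) ∈ fieldL d := by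
  have : ((√2 : ℝ) : ℂ) = zetaEight * (1 - Complex.I) := by
    rw [zetaEight_eq]
    push_cast
    linear_combination (√2 : ℂ) / 2 * Complex.I_sq
  rw [this]
  exact mul_mem zetaEight_mem_fieldL (sub_mem (one_mem _) I_mem_fieldL)

/-- Because ζ₈ = (√2/2)(1 + i), L_d is K(i) with K = ℚ(√2, √d) real. -/
theorem mem_fieldL_iff {z : ℂ} :
    z ∈ fieldL d ↔ z.re ∈ realBiquadratic d ∧ z.im ∈ realBiquadratic d := by
  constructor
  · intro hz
    let B : Subalgebra ℚ ℂ :=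
      { carrier := {z | z.re ∈ realBiquadratic d ∧ z.im ∈ realBiquadratic d}
        mul_mem' := by
          rintro x y ⟨h1, h2⟩ ⟨h3, h4⟩
          exact ⟨by rw [Complex.mul_re]; exact sub_mem (mul_mem h1 h3) (mul_mem h2 h4),
            by rw [Complex.mul_im]; exact add_mem (mul_mem h1 h4) (mul_mem h2 h3)⟩
        add_mem' := by
          rintro x y ⟨h1, h2⟩ ⟨h3, h4⟩
          exact ⟨add_mem h1 h3, add_mem h2 h4⟩
        algebraMap_mem' := fun q => ⟨by simpa using ratCast_mem_realBiquadratic d q,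
          by simp [zero_mem]⟩ }
    have h1 : z ∈ (fieldL d).toSubalgebra := hz
    rw [fieldL, IntermediateField.adjoin_toSubalgebra_of_isAlgebraic] at h1
    · have : Algebra.adjoin ℚ {zetaEight, ((√d : ℝ) : ℂ)} ≤ B := by
        apply Algebra.adjoin_le
        have h2 : √2 / 2 ∈ realBiquadratic d := mem_realBiquadratic_iff.2 ⟨0, 1 / 2, 0, 0, by
          push_cast; ring⟩
        rintro w (rfl | rfl)
        · rw [zetaEight_eq]
          exact ⟨by simpa using h2, by simpa using h2⟩
        · exact ⟨by simpa using sqrt_mem_realBiquadratic d, by simp [zero_mem]⟩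
      exact this h1
    · rintro w (rfl | rfl)
      · refine IsAlgebraic.of_pow two_pos ?_
        rw [zetaEight_sq]
        exact isAlgebraic_of_sq_eq (q := -1) (by simp)
      · exact isAlgebraic_of_sq_eq (q := d) (by exact_mod_cast sq_sqrt_natCast d)
  · have key (x : ℝ) (hx : x ∈ realBiquadratic d) : (x : ℂ) ∈ fieldL d := by
      obtain ⟨a, b, c, e, rfl⟩ := mem_realBiquadratic_iff.1 hx
      push_cast
      exact add_mem (add_mem (SubfieldClass.ratCast_mem _ _)
        (mul_mem (SubfieldClass.ratCast_mem _ _) sqrt_two_mem_fieldL))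
        (mul_mem (add_mem (SubfieldClass.ratCast_mem _ _)
        (mul_mem (SubfieldClass.ratCast_mem _ _) sqrt_two_mem_fieldL)) sqrt_mem_fieldL)
    rintro ⟨h1, h2⟩
    rw [← Complex.re_add_im z]
    exact add_mem (key _ h1) (mul_mem (key _ h2) I_mem_fieldL)

theorem ofReal_mem_fieldL_iff {x : ℝ} : (x : ℂ) ∈ fieldL d ↔ x ∈ realBiquadratic d := by
  rw [mem_fieldL_iff]
  simp [zero_mem]

theorem inv_mem_realBiquadratic {x : ℝ} (hx : x ∈ realBiquadratic d) :
    x⁻¹ ∈ realBiquadratic d := by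
  rw [← ofReal_mem_fieldL_iff] at hx ⊢
  push_cast
  exact inv_mem hx

theorem conj_mem_fieldL {z : ℂ} (hz : z ∈ fieldL d) : (starRingEnd ℂ) z ∈ fieldL d := by
  rw [mem_fieldL_iff] at hz ⊢
  simpa using hz

instance numberField_fieldL : NumberField (fieldL d) where
  to_charZero := inferInstance
  to_finiteDimensional := by
    apply IntermediateField.finiteDimensional_adjoin
    rintro w (rfl | rfl)
    · refine IsIntegral.of_pow (n := 4) (by norm_num) ?_
      have : zetaEight ^ 4 = -1 := by
        rw [show 4 = 2 * 2 by norm_num, pow_mul, zetaEight_sq, Complex.I_sq]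
      rw [this]
      exact isIntegral_one.neg
    · exact (isAlgebraic_of_sq_eq (q := d) (by exact_mod_cast sq_sqrt_natCast d)).isIntegral

/-- Coordinates with respect to the products of `√2`, `√d` and `i`. -/
theorem exists_coordinates (z : fieldL d) : ∃ a b c e a' b' c' e' : ℚ,
    z = a + b * ⟨_, sqrt_two_mem_fieldL⟩ + (c + e * ⟨_, sqrt_two_mem_fieldL⟩) * ⟨_, sqrt_mem_fieldL⟩ +
      (a' + b' * ⟨_, sqrt_two_mem_fieldL⟩ + (c' + e' * ⟨_, sqrt_two_mem_fieldL⟩) *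
        ⟨_, sqrt_mem_fieldL⟩) * ⟨_, I_mem_fieldL⟩ := by
  obtain ⟨h1, h2⟩ := mem_fieldL_iff.1 z.2
  obtain ⟨a, b, c, e, h⟩ := mem_realBiquadratic_iff.1 h1
  obtain ⟨a', b', c', e', h'⟩ := mem_realBiquadratic_iff.1 h2
  refine ⟨a, b, c, e, a', b', c', e', ?_⟩
  apply Subtype.ext
  have := (Complex.re_add_im (z : ℂ)).symm
  rw [h, h'] at this
  rw [this]
  push_cast
  rfl

/-- Every complex embedding of `L_d` changes the signs of `√2`, `√d` and `i`. -/
theorem exists_signs (φ : fieldL d →+* ℂ) : ∃ s t i : ℚ, s ^ 2 = 1 ∧ t ^ 2 = 1 ∧ i ^ 2 = 1 ∧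
    φ ⟨_, sqrt_two_mem_fieldL⟩ = s * (√2 : ℝ) ∧ φ ⟨_, sqrt_mem_fieldL⟩ = t * (√d : ℝ) ∧
    φ ⟨_, I_mem_fieldL⟩ = i * Complex.I := by
  have key (z : ℂ) (hz : z ∈ fieldL d) (q : ℚ) (hq : z ^ 2 = q) :
      ∃ s : ℚ, s ^ 2 = 1 ∧ φ ⟨z, hz⟩ = s * z := by
    have h1 : (⟨z, hz⟩ : fieldL d) ^ 2 = q := by
      apply Subtype.ext
      push_cast
      exact hq
    have h2 : φ ⟨z, hz⟩ ^ 2 = z ^ 2 := by rw [← map_pow, h1, map_ratCast, hq]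
    rcases sq_eq_sq_iff_eq_or_eq_neg.1 h2 with h | h
    · exact ⟨1, by norm_num, by simpa using h⟩
    · exact ⟨-1, by norm_num, by simpa using h⟩
  obtain ⟨s, hs, hs'⟩ := key _ sqrt_two_mem_fieldL 2 (by
    rw [← Complex.ofReal_pow, Real.sq_sqrt (by norm_num)]; simp)
  obtain ⟨t, ht, ht'⟩ := key _ sqrt_mem_fieldL d (by exact_mod_cast sq_sqrt_natCast d)
  obtain ⟨i, hi, hi'⟩ := key _ I_mem_fieldL (-1) (by simp)
  exact ⟨s, t, i, hs, ht, hi, hs', ht', hi'⟩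

/-- The Galois group of L_d has exponent 2, since each embedding only changes signs of √2, √d and i.
-/
theorem embedding_involutive (φ : fieldL d →+* ℂ) {z w : fieldL d} (h : φ z = w) : φ w = z := by
  obtain ⟨s, t, i, hs, ht, hi, hs', ht', hi'⟩ := exists_signs φ
  obtain ⟨a, b, c, e, a', b', c', e', rfl⟩ := exists_coordinates z
  have hw : w = a + b * (s * ⟨_, sqrt_two_mem_fieldL⟩) +
      (c + e * (s * ⟨_, sqrt_two_mem_fieldL⟩)) * (t * ⟨_, sqrt_mem_fieldL⟩) +
      (a' + b' * (s * ⟨_, sqrt_two_mem_fieldL⟩) + (c' + e' * (s * ⟨_, sqrt_two_mem_fieldL⟩)) *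
        (t * ⟨_, sqrt_mem_fieldL⟩)) * (i * ⟨_, I_mem_fieldL⟩) := by
    apply Subtype.ext
    rw [← h]
    simp only [map_add, map_mul, map_ratCast, hs', ht', hi']
    rfl
  have hsc : (s : ℂ) ^ 2 = 1 := by exact_mod_cast hs
  have htc : (t : ℂ) ^ 2 = 1 := by exact_mod_cast ht
  have hic : (i : ℂ) ^ 2 = 1 := by exact_mod_cast hi
  have e1 (x : ℂ) : (s : ℂ) * (s * x) = x := by rw [← mul_assoc, ← sq, hsc, one_mul]
  have e2 (x : ℂ) : (t : ℂ) * (t * x) = x := by rw [← mul_assoc, ← sq, htc, one_mul]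
  have e3 (x : ℂ) : (i : ℂ) * (i * x) = x := by rw [← mul_assoc, ← sq, hic, one_mul]
  rw [hw]
  simp only [map_add, map_mul, map_ratCast, hs', ht', hi', e1, e2, e3]
  rfl

theorem embedding_conj (φ : fieldL d →+* ℂ) (z : fieldL d) :
    φ ⟨_, conj_mem_fieldL z.2⟩ = (starRingEnd ℂ) (φ z) := by
  obtain ⟨s, t, i, -, -, -, hs', ht', hi'⟩ := exists_signs φ
  obtain ⟨a, b, c, e, a', b', c', e', hz⟩ := exists_coordinates z
  have hw : (⟨_, conj_mem_fieldL z.2⟩ : fieldL d) = a + b * ⟨_, sqrt_two_mem_fieldL⟩ +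
      (c + e * ⟨_, sqrt_two_mem_fieldL⟩) * ⟨_, sqrt_mem_fieldL⟩ +
      (a' + b' * ⟨_, sqrt_two_mem_fieldL⟩ + (c' + e' * ⟨_, sqrt_two_mem_fieldL⟩) *
        ⟨_, sqrt_mem_fieldL⟩) * (-⟨_, I_mem_fieldL⟩) := by
    apply Subtype.ext
    simp [hz]
  rw [hw, hz]
  simp only [map_add, map_mul, map_ratCast, hs', ht', hi', map_neg, Complex.conj_ofReal,
    Complex.conj_I]
  simp

/-- The power z^a has the same minimal polynomial as z, so some embedding sends z to z^a; applied
twice it is the identity. -/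
theorem pow_mul_self_eq_of_coprime {z : ℂ} (hz : z ∈ fieldL d) {k a : ℕ} (hk : 0 < k)
    (hprim : IsPrimitiveRoot z k) (ha : a.Coprime k) : z ^ (a * a) = z := by
  have hprim' : IsPrimitiveRoot (⟨z, hz⟩ : fieldL d) k :=
    IsPrimitiveRoot.of_map_of_injective (f := algebraMap (fieldL d) ℂ) hprim
      (algebraMap (fieldL d) ℂ).injective
  have hmin := hprim'.minpoly_eq_pow_coprime ha
  have hint : IsIntegral ℤ (⟨z, hz⟩ : fieldL d) := hprim'.isIntegral hk
  have hroot : z ^ a ∈ (minpoly ℚ (⟨z, hz⟩ : fieldL d)).rootSet ℂ := by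
    rw [Polynomial.mem_rootSet]
    refine ⟨minpoly.ne_zero hint.tower_top, ?_⟩
    rw [minpoly.isIntegrallyClosed_eq_field_fractions' ℚ hint, hmin,
      ← minpoly.isIntegrallyClosed_eq_field_fractions' ℚ (hint.pow a)]
    have : (z ^ a : ℂ) = algebraMap (fieldL d) ℂ (⟨z, hz⟩ ^ a) := rfl
    rw [this, Polynomial.aeval_algebraMap_apply, minpoly.aeval, map_zero]
  rw [← NumberField.Embeddings.range_eval_eq_rootSet_minpoly] at hroot
  obtain ⟨φ, hφ⟩ := hroot
  have hφ' : φ ⟨z, hz⟩ = ((⟨z, hz⟩ ^ a : fieldL d) : ℂ) := hφ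
  have := embedding_involutive φ hφ'
  rw [map_pow, hφ'] at this
  rw [pow_mul]
  exact this

namespace BiquadraticUnitData

/-- An element of order 5 would satisfy z⁴ = z, so 5 does not divide the order and a = 5 gives z²⁴ =
1. If z⁸ ≠ 1, it is a primitive cube root of unity ω, and 2ω + 1 = ±√-3 puts √3 in K. -/
theorem pow_eight_eq_one (D : BiquadraticUnitData d) {z : ℂ} (hz : z ∈ fieldL d) {n : ℕ}
    (hn : 0 < n) (h : z ^ n = 1) : z ^ 8 = 1 := by
  have hk : 0 < orderOf z := (isOfFinOrder_iff_pow_eq_one.2 ⟨n, hn, h⟩).orderOf_pos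
  have hprim := IsPrimitiveRoot.orderOf z
  have hz0 : z ≠ 0 := by
    rintro rfl
    rw [zero_pow hn.ne'] at h
    exact zero_ne_one h
  have h5 : ¬ 5 ∣ orderOf z := by
    rintro ⟨m, hm⟩
    have hp5 : IsPrimitiveRoot (z ^ m) 5 := hprim.pow hk (by rw [hm, mul_comm])
    have := pow_mul_self_eq_of_coprime (pow_mem hz m) (by norm_num) hp5
      (a := 2) (by norm_num)
    have h3 : (z ^ m) ^ 3 = 1 := by
      apply mul_right_cancel₀ (pow_ne_zero m hz0)
      rw [one_mul]
      calc (z ^ m) ^ 3 * z ^ m = (z ^ m) ^ (2 * 2) := by ring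
        _ = z ^ m := this
    have := hp5.dvd_of_pow_eq_one 3 h3
    omega
  have h25 := pow_mul_self_eq_of_coprime hz hk hprim (a := 5)
    ((Nat.Prime.coprime_iff_not_dvd (by norm_num)).2 h5)
  have h24 : (z ^ 8) ^ 3 = 1 := by
    apply mul_right_cancel₀ hz0
    rw [one_mul]
    calc (z ^ 8) ^ 3 * z = z ^ (5 * 5) := by ring
      _ = z := h25
  by_contra hne
  have h3 : (2 * z ^ 8 + 1) ^ 2 = -3 := by
    have : (z ^ 8 - 1) * ((z ^ 8) ^ 2 + z ^ 8 + 1) = 0 := by linear_combination h24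
    have := (mul_eq_zero.1 this).resolve_left (sub_ne_zero.2 hne)
    linear_combination 4 * this
  have hmem : 2 * z ^ 8 + 1 ∈ fieldL d :=
    add_mem (mul_mem (ofNat_mem _ 2) (pow_mem hz 8)) (one_mem _)
  generalize 2 * z ^ 8 + 1 = v at h3 hmem
  have him := (mem_fieldL_iff.1 hmem).2
  have e1 := congrArg Complex.re h3
  have e2 := congrArg Complex.im h3
  rw [sq, Complex.mul_re] at e1
  rw [sq, Complex.mul_im] at e2
  simp at e1 e2
  have e3 : v.re * v.im = 0 := by linarith
  rcases mul_eq_zero.1 e3 with h | h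
  · apply D.sq_ne_three him
    rw [h] at e1
    linarith
  · rw [h] at e1
    nlinarith [mul_self_nonneg v.re]

theorem _root_.isIntegral_conj {z : ℂ} (h : IsIntegral ℤ z) : IsIntegral ℤ ((starRingEnd ℂ) z) :=
  h.map (starRingEnd ℂ).toIntAlgHom

/-- For a unit `u` of `L_d`, the quotient `u / ū` is a power of `ζ₈`. -/
theorem exists_pow_zetaEight_eq (D : BiquadraticUnitData d) {u : ℂ} (hu : u ∈ fieldL d)
    (hu0 : u ≠ 0) (hi : IsIntegral ℤ u) (hi' : IsIntegral ℤ u⁻¹) :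
    ∃ j : ℕ, u = zetaEight ^ j * (starRingEnd ℂ) u := by
  have hc := conj_mem_fieldL hu
  have hc0 : (starRingEnd ℂ) u ≠ 0 := by simpa using hu0
  have hint : IsIntegral ℤ (⟨u, hu⟩ * ⟨_, hc⟩⁻¹ : fieldL d) := by
    rw [← isIntegral_algebraMap_iff (algebraMap (fieldL d) ℂ).injective]
    have : algebraMap (fieldL d) ℂ (⟨u, hu⟩ * ⟨_, hc⟩⁻¹) = u * (starRingEnd ℂ) u⁻¹ := by
      rw [map_inv₀]; rfl
    rw [this]
    exact hi.mul (isIntegral_conj hi')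
  -- Kronecker's theorem: embeddings commute with complex conjugation, so all conjugates of u/ū have
  -- absolute value 1.
  obtain ⟨n, hn, hpow⟩ := NumberField.Embeddings.pow_eq_one_of_norm_eq_one (fieldL d) ℂ hint (by
    intro φ
    have : φ ⟨u, hu⟩ ≠ 0 := by
      rw [map_ne_zero]
      intro h
      exact hu0 (congrArg Subtype.val h)
    rw [map_mul, map_inv₀, embedding_conj φ ⟨u, hu⟩, norm_mul, norm_inv, RCLike.norm_conj]
    exact mul_inv_cancel₀ (norm_ne_zero_iff.2 this))
  have hpow' : (u * ((starRingEnd ℂ) u)⁻¹) ^ n = 1 := congrArg Subtype.val hpow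
  have h8 := D.pow_eight_eq_one (mul_mem hu (inv_mem hc)) hn hpow'
  obtain ⟨j, -, hj⟩ := isPrimitiveRoot_zetaEight.eq_pow_of_pow_eq_one h8
  exact ⟨j, by rw [hj]; field_simp⟩

theorem _root_.isQuadraticUnit_two_sqrt_two_sub_one : IsQuadraticUnit 2 (√2 - 1) := by
  have := IsQuadraticUnit.of_norm (m := 2) (a := -1) (b := 1) (T := -2) (by norm_num)
    (Or.inr (by norm_num))
  have e : (((-1 : ℚ) : ℝ) + ((1 : ℚ) : ℝ) * √((2 : ℕ) : ℝ)) = √2 - 1 := by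
    push_cast; ring
  rwa [e] at this

/-- The unit index of Hasse of `L_d` is `1`: every unit is a root of unity times a real unit. -/
theorem exists_pow_mul_real (D : BiquadraticUnitData d) {u : ℂ} (hu : u ∈ fieldL d)
    (hu0 : u ≠ 0) (hi : IsIntegral ℤ u) (hi' : IsIntegral ℤ u⁻¹) :
    ∃ (j : ℕ) (x : ℝ), u = zetaEight ^ j * x := by
  have hζ0 := zetaEight_ne_zero
  obtain ⟨j, hj⟩ := D.exists_pow_zetaEight_eq hu hu0 hi hi'
  have hreal {v : ℂ} (h : v = (starRingEnd ℂ) v) : v = (v.re : ℂ) :=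
    (Complex.conj_eq_iff_re.1 h.symm).symm
  obtain ⟨v, hv⟩ : ∃ v, v = (zetaEight ^ (j / 2))⁻¹ * u := ⟨_, rfl⟩
  have huv : u = zetaEight ^ (j / 2) * v := by rw [hv]; field_simp
  have hcv : (starRingEnd ℂ) v = zetaEight ^ (j / 2) * (starRingEnd ℂ) u := by
    rw [hv, map_mul, map_inv₀, map_pow, conj_zetaEight, inv_pow, inv_inv]
  rcases Nat.even_or_odd' j with ⟨k, rfl | rfl⟩
  · have hk : 2 * k / 2 = k := by omega
    rw [hk] at hv huv hcv
    refine ⟨k, v.re, ?_⟩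
    rw [← hreal, huv]
    rw [hcv, hv]
    nth_rewrite 1 [hj]
    rw [two_mul, pow_add]
    field_simp
  · exfalso
    have hk : (2 * k + 1) / 2 = k := by omega
    rw [hk] at hv huv hcv
    have hvv : v = zetaEight * (starRingEnd ℂ) v := by
      rw [hcv, hv]
      nth_rewrite 1 [hj]
      rw [pow_succ, two_mul, pow_add]
      field_simp
    have hv0 : v ≠ 0 := by
      rintro rfl
      apply hu0
      rw [huv, mul_zero]
    have hζi : IsIntegral ℤ zetaEight := isPrimitiveRoot_zetaEight.isIntegral (by norm_num)
    have hζi' : IsIntegral ℤ zetaEight⁻¹ := by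
      rw [← conj_zetaEight]; exact isIntegral_conj hζi
    have hvmem : v ∈ fieldL d := by
      rw [hv]; exact mul_mem (inv_mem (pow_mem zetaEight_mem_fieldL _)) hu
    have hvi : IsIntegral ℤ v := by
      rw [hv, ← inv_pow]; exact (hζi'.pow k).mul hi
    have hvi' : IsIntegral ℤ v⁻¹ := by
      rw [hv, mul_inv, inv_inv]; exact (hζi.pow k).mul hi'
    have h1ζ : 1 + zetaEight ≠ 0 := by
      intro h
      have := zetaEight_sq
      rw [eq_neg_of_add_eq_zero_right h] at this
      have := congrArg Complex.im this
      simp at this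
    -- Both v and 1 + ζ₈ equal ζ₈ times their conjugates, so r is real and |v|² = (2 + √2)r².
    -- Multiplying by the unit √2 - 1 gives the forbidden unit √2·r².
    obtain ⟨r, hr⟩ : ∃ r, r = v / (1 + zetaEight) := ⟨_, rfl⟩
    have hrreal : r = (r.re : ℂ) := by
      apply hreal
      rw [hr, map_div₀, map_add, map_one, conj_zetaEight]
      have : 1 + zetaEight⁻¹ = (1 + zetaEight) * zetaEight⁻¹ := by field_simp; ring
      rw [this]
      nth_rewrite 1 [hvv]
      field_simp
    have hrmem : r.re ∈ realBiquadratic d := by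
      rw [← ofReal_mem_fieldL_iff, ← hrreal, hr]
      exact div_mem hvmem (add_mem (one_mem _) zetaEight_mem_fieldL)
    have hs2 : (√2 : ℝ) ^ 2 = 2 := Real.sq_sqrt (by norm_num)
    have hnormζ : Complex.normSq (1 + zetaEight) = 2 + √2 := by
      rw [zetaEight_eq, Complex.normSq_apply]
      simp
      linear_combination hs2 / 2
    have hnv : Complex.normSq v = (2 + √2) * r.re ^ 2 := by
      have : v = r * (1 + zetaEight) := by rw [hr]; field_simp
      rw [this, map_mul, hnormζ, hrreal, Complex.normSq_ofReal]
      simp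
      ring
    have hn0 : Complex.normSq v ≠ 0 := by rwa [Ne, Complex.normSq_eq_zero]
    have hni : IsIntegral ℤ (Complex.normSq v) := by
      rw [← isIntegral_ofReal_iff, ← Complex.mul_conj]
      exact hvi.mul (isIntegral_conj hvi)
    have hni' : IsIntegral ℤ (Complex.normSq v)⁻¹ := by
      rw [← isIntegral_ofReal_iff, Complex.ofReal_inv, ← Complex.mul_conj, mul_inv, ← map_inv₀]
      exact hvi'.mul (isIntegral_conj hvi')
    have hnmem : Complex.normSq v ∈ realBiquadratic d := by
      rw [← ofReal_mem_fieldL_iff, ← Complex.mul_conj]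
      exact mul_mem hvmem (conj_mem_fieldL hvmem)
    obtain ⟨g0, g1, g2, -⟩ := isQuadraticUnit_two_sqrt_two_sub_one
    have hxmem : Complex.normSq v * (√2 - 1) ∈ realBiquadratic d :=
      mul_mem hnmem (sub_mem (sqrt_two_mem_realBiquadratic d) (one_mem _))
    refine D.not_unit_sqrt_two_mul_sq hrmem (mul_ne_zero hn0 g0) hxmem
      (inv_mem_realBiquadratic hxmem) (hni.mul g1) (by rw [mul_inv]; exact hni'.mul g2) ?_
    rw [hnv]
    linear_combination r.re ^ 2 * hs2

end BiquadraticUnitData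

end fieldL

/-! ### Verification of the arithmetic data for d = q₁q₂ -/

section primes

variable {q₁ q₂ : ℕ}

/-- At least one of q₁, q₂ differs from q, and it divides the product exactly once. -/
theorem not_isSquare_mul_mul_mul {q t : ℕ} (hp₁ : q₁.Prime) (hp₂ : q₂.Prime) (hne : q₁ ≠ q₂)
    (h₁ : q₁ % 8 = 3) (h₂ : q₂ % 8 = 3) (hq : q.Prime) (ht : t ∣ 2) :
    ¬ IsSquare (t * (q₁ * q₂) * q) := by
  have key {p p' : ℕ} (hp : p.Prime) (hp' : p'.Prime) (h : p % 8 = 3) (hpp : p ≠ p') (hpq : p ≠ q) :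
      ¬ IsSquare (p * (t * p' * q)) := by
    apply hp.not_isSquare_mul
    intro hd
    rcases hp.dvd_mul.1 hd with hd | hd
    · rcases hp.dvd_mul.1 hd with hd | hd
      · have := Nat.le_of_dvd two_pos (hd.trans ht)
        have := hp.two_le
        omega
      · exact hpp ((Nat.prime_dvd_prime_iff_eq hp hp').1 hd)
    · exact hpq ((Nat.prime_dvd_prime_iff_eq hp hq).1 hd)
  by_cases h : q₁ = q
  · have := key hp₂ hp₁ h₂ hne.symm (fun h' => hne (h.trans h'.symm))
    rwa [show t * (q₁ * q₂) * q = q₂ * (t * q₁ * q) by ring]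
  · have := key hp₁ hp₂ h₁ hne h
    rwa [show t * (q₁ * q₂) * q = q₁ * (t * q₂ * q) by ring]

/-- If √q = a√m up to sign, with m ∈ {1, 2, d, 2d}, then mq = (ma)² is a square, which no such m
allows. It is applied to q = q₁ and q = 3. -/
theorem sq_ne_prime_of_mem_realBiquadratic {q : ℕ} (hp₁ : q₁.Prime) (hp₂ : q₂.Prime)
    (hne : q₁ ≠ q₂) (h₁ : q₁ % 8 = 3) (h₂ : q₂ % 8 = 3) (hq : q.Prime) (h : q % 8 = 3) {y : ℝ}
    (hy : y ∈ realBiquadratic (q₁ * q₂)) : y ^ 2 ≠ q := by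
  intro hyq
  have h2d : ¬ IsSquare (2 * (q₁ * q₂)) := by
    rw [← mul_assoc]; exact not_isSquare_two_mul_mul hp₁ hp₂ hne h₁ h₂
  have key (m : ℕ) (a : ℚ) (hm : ¬ IsSquare (m * q)) (hya : y = a * √m) : False := by
    apply rat_sq_ne_natCast hm (m * a)
    have : (m : ℝ) * (a * √m) ^ 2 = m * q := by rw [← hya, hyq]
    rw [mul_pow, sq_sqrt_natCast] at this
    have h' : ((m : ℚ) * a) ^ 2 = m * q := by
      have : (((m : ℚ) * a : ℚ) : ℝ) ^ 2 = m * q := by push_cast; linarith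
      exact_mod_cast this
    rw [h']
    push_cast
    ring
  obtain ⟨a, ha | ha | ha | ha⟩ := eq_or_of_sq_eq_ratCast
    (not_isSquare_mul_of_prime hp₁ hp₂ hne) h2d hy (n := q) (by simpa using hyq)
  · refine key 1 a ?_ (by simpa using ha)
    rw [mul_comm]
    exact hq.not_isSquare_mul (fun h' => hq.one_lt.ne' (Nat.dvd_one.1 h'))
  · refine key 2 a ?_ (by simpa using ha)
    rw [mul_comm]
    refine hq.not_isSquare_mul (fun h' => ?_)
    have := Nat.le_of_dvd two_pos h'
    have := hq.two_le
    omega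
  · refine key _ a ?_ ha
    simpa using not_isSquare_mul_mul_mul (t := 1) hp₁ hp₂ hne h₁ h₂ hq (one_dvd 2)
  · exact key _ a (not_isSquare_mul_mul_mul hp₁ hp₂ hne h₁ h₂ hq dvd_rfl) ha

theorem biquadraticUnitData_mul (hp₁ : q₁.Prime) (hp₂ : q₂.Prime) (hne : q₁ ≠ q₂)
    (h₁ : q₁ % 8 = 3) (h₂ : q₂ % 8 = 3) : BiquadraticUnitData (q₁ * q₂) where
  squarefree := squarefree_mul_of_prime hp₁ hp₂ hne
  odd := Nat.odd_iff.2 (by have := mul_mod_eight h₁ h₂; omega)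
  not_isSquare := not_isSquare_mul_of_prime hp₁ hp₂ hne
  not_isSquare_two_mul := by
    rw [← mul_assoc]; exact not_isSquare_two_mul_mul hp₁ hp₂ hne h₁ h₂
  exists_int hx := hx.exists_int (squarefree_mul_of_prime hp₁ hp₂ hne)
    (not_isSquare_mul_of_prime hp₁ hp₂ hne) (Or.inl (mul_mod_eight h₁ h₂)) hp₁ (by omega)
    (dvd_mul_right _ _)
  exists_sqrt := by
    rw [← mul_assoc]
    exact exists_sqrt_fundamentalUnit_two_mul_mul hp₁ hp₂ hne h₁ h₂
  sqrt_notMem := by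
    intro hmem
    obtain ⟨u, v, huv⟩ := exists_sqrt_fundamentalUnit_mul hp₁ hp₂ hne h₁ h₂
    have hpos : 0 < √(fundamentalUnit (q₁ * q₂)) := Real.sqrt_pos.2
      (one_pos.trans (one_lt_fundamentalUnit (not_isSquare_mul_of_prime hp₁ hp₂ hne)))
    -- Since √q₁·√ε_d = uq₁ + v√d lies in K, √ε_d ∈ K would imply √q₁ ∈ K.
    have e : √(q₁ : ℝ) = (u * q₁ + v * √(q₁ * q₂ : ℕ)) * (√(fundamentalUnit (q₁ * q₂)))⁻¹ := by
      rw [eq_mul_inv_iff_mul_eq₀ hpos.ne', huv]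
      push_cast
      rw [Real.sqrt_mul (Nat.cast_nonneg q₁)]
      linear_combination u * sq_sqrt_natCast q₁
    apply sq_ne_prime_of_mem_realBiquadratic hp₁ hp₂ hne h₁ h₂ hp₁ h₁ (y := √q₁)
    · rw [e]
      exact mul_mem (add_mem (mul_mem (intCast_mem _ u) (natCast_mem _ q₁))
        (mul_mem (intCast_mem _ v) (sqrt_mem_realBiquadratic _))) (inv_mem_realBiquadratic hmem)
    · exact sq_sqrt_natCast q₁
  sq_ne_three hy := by
    exact_mod_cast sq_ne_prime_of_mem_realBiquadratic hp₁ hp₂ hne h₁ h₂ Nat.prime_three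
      (by norm_num) hy

end primes

/-! ### Quadratic subfields and subgroups of index 2 -/

theorem finrank_adjoin_of_sq_eq {z : ℂ} {q : ℚ} (hz : z ^ 2 = q) (hq : ∀ b : ℚ, b ^ 2 ≠ q) :
    Module.finrank ℚ ℚ⟮z⟯ = 2 := by
  rw [adjoin.finrank (isAlgebraic_of_sq_eq hz).isIntegral,
    ← minpoly.eq_of_irreducible_of_monic (X_pow_sub_C_irreducible_of_prime Nat.prime_two hq)
      (by simp [hz]) (Polynomial.monic_X_pow_sub_C q two_ne_zero),
    Polynomial.natDegree_X_pow_sub_C]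

theorem finrank_quadraticFieldIn {m : ℕ} (hm : ¬ IsSquare m) :
    Module.finrank ℚ (quadraticFieldIn m) = 2 := by
  have hs : ((√m : ℝ) : ℂ) ^ 2 = (m : ℚ) := by exact_mod_cast sq_sqrt_natCast m
  have : quadraticFieldIn m = ℚ⟮((√m : ℝ) : ℂ)⟯ := by
    apply le_antisymm
    · intro z hz
      obtain ⟨a, b, rfl⟩ := mem_quadraticFieldIn_iff.1 hz
      push_cast
      exact add_mem (SubfieldClass.ratCast_mem _ _)
        (mul_mem (SubfieldClass.ratCast_mem _ _) (mem_adjoin_simple_self ℚ _))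
    · rw [adjoin_simple_le_iff]
      exact subset_adjoin _ _ (by simpa using hs)
  rw [this]
  exact finrank_adjoin_of_sq_eq hs (rat_sq_ne_natCast hm)

/-- Cayley–Hamilton for multiplication by u, which covers rational u as well. -/
theorem exists_sq_eq_of_finrank_eq_two {k : IntermediateField ℚ ℂ}
    (hk : Module.finrank ℚ k = 2) {u : ℂ} (hu : u ∈ k) : ∃ T N : ℚ, u ^ 2 = T * u - N := by
  have : FiniteDimensional ℚ k := Module.finite_of_finrank_pos (by omega)
  have h1 := Algebra.aeval_self_charpoly_lmul (R := ℚ) (⟨u, hu⟩ : k)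
  have hmon := (Algebra.lmul ℚ k ⟨u, hu⟩).charpoly_monic
  have hdeg := (Algebra.lmul ℚ k ⟨u, hu⟩).charpoly_natDegree
  generalize (Algebra.lmul ℚ k ⟨u, hu⟩).charpoly = p at h1 hmon hdeg
  rw [hk] at hdeg
  have hp := Polynomial.eq_quadratic_of_degree_le_two
    (Polynomial.natDegree_le_iff_degree_le.1 hdeg.le)
  have h2 : p.coeff 2 = 1 := by rw [← hdeg]; exact hmon
  rw [hp, h2] at h1
  simp at h1
  have h3 := congrArg Subtype.val h1
  push_cast at h3
  refine ⟨-p.coeff 1, p.coeff 0, ?_⟩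
  push_cast
  have h4 : u ^ 2 + p.coeff 1 * u + p.coeff 0 = 0 := h3
  linear_combination h4

/-- The coset of an element x^n·h is determined by the parity of n. -/
theorem Subgroup.relIndex_closure_insert_eq_two {G : Type*} [CommGroup G] (S : Set G) {x : G}
    (hx : x ∉ closure S) (hx2 : x ^ 2 ∈ closure S) :
    (closure S).relIndex (closure (insert x S)) = 2 := by
  rw [relIndex_eq_two_iff_exists_notMem_and]
  refine ⟨x, subset_closure (by simp), hx, fun b hb => ?_⟩
  rw [Set.insert_eq, closure_union, mem_sup] at hb
  obtain ⟨y, hy, h, hh, rfl⟩ := hb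
  obtain ⟨n, rfl⟩ := mem_closure_singleton.1 hy
  rcases Int.even_or_odd' n with ⟨k, rfl | rfl⟩
  · right
    refine mul_mem ?_ hh
    rw [zpow_mul]
    exact zpow_mem (by exact_mod_cast hx2) k
  · left
    have : x ^ (2 * k + 1) * h * x = (x ^ 2) ^ (k + 1) * h := by
      rw [mul_right_comm, ← zpow_add_one, ← zpow_natCast, ← zpow_mul]
      congr 2
      push_cast
      ring
    rw [this]
    exact mul_mem (zpow_mem hx2 _) hh

/-! ### The unit group of L_d and the unit index -/

namespace BiquadraticUnitData

variable {d : ℕ}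

theorem mem_unitGroupIn_ofReal {u : ℂˣ} {x : ℝ} (hu : (u : ℂ) = x) :
    u ∈ unitGroupIn (fieldL d) ↔ x ∈ realBiquadratic d ∧ IsIntegral ℤ x ∧ IsIntegral ℤ x⁻¹ := by
  rw [mem_unitGroupIn_iff, hu, ofReal_mem_fieldL_iff, isIntegral_ofReal_iff, ← Complex.ofReal_inv,
    isIntegral_ofReal_iff]

section generators

variable {ζ e₂ e_d s : ℂˣ}

theorem zeta_mem_unitGroupIn (hζ : (ζ : ℂ) = zetaEight) : ζ ∈ unitGroupIn (fieldL d) := by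
  have hζi : IsIntegral ℤ zetaEight := isPrimitiveRoot_zetaEight.isIntegral (by norm_num)
  rw [mem_unitGroupIn_iff, hζ]
  exact ⟨zetaEight_mem_fieldL, hζi, by rw [← conj_zetaEight]; exact isIntegral_conj hζi⟩

theorem unitGroupIn_eq_closure (D : BiquadraticUnitData d) (hζ : (ζ : ℂ) = zetaEight)
    (h₂ : (e₂ : ℂ) = fundamentalUnit 2) (h_d : (e_d : ℂ) = fundamentalUnit d)
    (hs : (s : ℂ) = √(fundamentalUnit (2 * d))) :
    unitGroupIn (fieldL d) = Subgroup.closure {ζ, e₂, e_d, s} := by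
  apply le_antisymm
  · intro u hu
    obtain ⟨hmem, hi, hi'⟩ := mem_unitGroupIn_iff.1 hu
    obtain ⟨j, x, hjx⟩ := D.exists_pow_mul_real hmem u.ne_zero hi hi'
    have hx0 : x ≠ 0 := by
      rintro rfl
      exact u.ne_zero (by rw [hjx]; simp)
    obtain ⟨v, hv⟩ : ∃ v : ℂˣ, (v : ℂ) = x :=
      ⟨Units.mk0 (x : ℂ) (by exact_mod_cast hx0), rfl⟩
    have huv : u = ζ ^ j * v := by
      apply Units.ext
      rw [hjx]
      push_cast
      rw [hζ, hv]
    have hvE : v ∈ unitGroupIn (fieldL d) := by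
      have : v = (ζ ^ j)⁻¹ * u := by rw [huv]; group
      rw [this]
      exact mul_mem (inv_mem (pow_mem (zeta_mem_unitGroupIn hζ) j)) hu
    obtain ⟨x1, x2, x3⟩ := (mem_unitGroupIn_ofReal hv).1 hvE
    have gζ : ζ ∈ Subgroup.closure {ζ, e₂, e_d, s} := Subgroup.subset_closure (by simp)
    have g2 : e₂ ∈ Subgroup.closure {ζ, e₂, e_d, s} := Subgroup.subset_closure (by simp)
    have gd : e_d ∈ Subgroup.closure {ζ, e₂, e_d, s} := Subgroup.subset_closure (by simp)
    have gs : s ∈ Subgroup.closure {ζ, e₂, e_d, s} := Subgroup.subset_closure (by simp)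
    have hpos {w : ℂˣ} {y : ℝ} (hw : (w : ℂ) = y) (hy : 0 < y) (h1 : y ∈ realBiquadratic d)
        (h2 : IsIntegral ℤ y) (h3 : IsIntegral ℤ y⁻¹) :
        w ∈ Subgroup.closure {ζ, e₂, e_d, s} := by
      obtain ⟨a, b, c, habc⟩ := D.exists_zpow_of_unit hy h1 (inv_mem_realBiquadratic h1) h2 h3
      have : w = e₂ ^ a * e_d ^ b * s ^ c := by
        apply Units.ext
        simp only [Units.val_mul, Units.val_zpow_eq_zpow_val]
        rw [hw, habc, h₂, h_d, hs]
        push_cast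
        rfl
      rw [this]
      exact mul_mem (mul_mem (zpow_mem g2 a) (zpow_mem gd b)) (zpow_mem gs c)
    rw [huv]
    refine mul_mem (pow_mem gζ j) ?_
    rcases lt_or_gt_of_ne hx0 with h | h
    -- The sign is absorbed by ζ₈⁴ = -1.
    · have hneg : v = ζ ^ 4 * -v := by
        apply Units.ext
        push_cast
        rw [hζ, show 4 = 2 * 2 by norm_num, pow_mul, zetaEight_sq, Complex.I_sq]
        ring
      rw [hneg]
      refine mul_mem (pow_mem gζ 4) (hpos (y := -x) (by push_cast; rw [hv]) (by linarith)
        (neg_mem x1) x2.neg ?_)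
      rw [inv_neg]
      exact x3.neg
    · exact hpos hv h x1 x2 x3
  · rw [Subgroup.closure_le]
    rintro w (rfl | rfl | rfl | rfl)
    · exact zeta_mem_unitGroupIn hζ
    · obtain ⟨-, i1, i2, -⟩ := isQuadraticUnit_fundamentalUnit not_isSquare_two
      exact (mem_unitGroupIn_ofReal h₂).2
        ⟨by simpa using fundamentalUnit_two_zpow_mem d 1, i1, i2⟩
    · obtain ⟨-, i1, i2, -⟩ := isQuadraticUnit_fundamentalUnit D.not_isSquare
      exact (mem_unitGroupIn_ofReal h_d).2 ⟨by simpa using D.fundamentalUnit_zpow_mem 1, i1, i2⟩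
    · obtain ⟨-, i1, i2, -⟩ := isQuadraticUnit_fundamentalUnit D.not_isSquare_two_mul
      have hsq : √(fundamentalUnit (2 * d)) ^ 2 = fundamentalUnit (2 * d) :=
        Real.sq_sqrt D.fundamentalUnit_two_mul_pos.le
      refine (mem_unitGroupIn_ofReal hs).2 ⟨by simpa using D.sqrt_fundamentalUnit_zpow_mem 1,
        IsIntegral.of_pow two_pos (by rwa [hsq]), IsIntegral.of_pow two_pos ?_⟩
      rwa [inv_pow, hsq]

/-- A non-real element `(T + w)/2` of norm `1` and integral trace `T`, with `w` imaginary, has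
order dividing `12`. -/
theorem _root_.pow_twelve_eq_one_of_imaginary {u : ℂ} {q : ℝ} {T : ℤ} (hq : q ≠ 0)
    (hu : 2 * u = T + q * Complex.I) (hN : (T : ℝ) ^ 2 + q ^ 2 = 4) : u ^ 12 = 1 := by
  have hT2 : T ^ 2 < 4 := by
    have : (T : ℝ) ^ 2 < 4 := by
      have : 0 < q ^ 2 := by positivity
      linarith
    exact_mod_cast this
  have hN' : (T : ℂ) ^ 2 + q ^ 2 = 4 := by exact_mod_cast hN
  have hrel : u ^ 2 = T * u - 1 := by
    have : 4 * u ^ 2 = 4 * (T * u - 1) := by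
      linear_combination (2 * u - T + q * Complex.I) * hu + (q : ℂ) ^ 2 * Complex.I_sq - hN'
    exact mul_left_cancel₀ (by norm_num) this
  have hT : T = -1 ∨ T = 0 ∨ T = 1 := by
    have h1 : -2 < T := by nlinarith
    have h2 : T < 2 := by nlinarith
    omega
  rcases hT with rfl | rfl | rfl <;> push_cast at hrel
  · have : u ^ 3 = 1 := by linear_combination (u - 1) * hrel
    rw [show 12 = 3 * 4 by norm_num, pow_mul, this, one_pow]
  · have : u ^ 2 = -1 := by linear_combination hrel
    rw [show 12 = 2 * 6 by norm_num, pow_mul, this]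
    norm_num
  · have : u ^ 3 = -1 := by linear_combination (u + 1) * hrel
    rw [show 12 = 3 * 4 by norm_num, pow_mul, this]
    norm_num

/-- The units of a quadratic subfield of `L_d`. -/
theorem eq_pow_I_or_isQuadraticUnit (D : BiquadraticUnitData d) {k : IntermediateField ℚ ℂ}
    (hk : k ≤ fieldL d) (hk2 : Module.finrank ℚ k = 2) {u : ℂˣ} (hu : u ∈ unitGroupIn k) :
    (∃ j : ℕ, (u : ℂ) = Complex.I ^ j) ∨ ∃ x : ℝ, (u : ℂ) = x ∧
      (IsQuadraticUnit 2 x ∨ IsQuadraticUnit d x ∨ IsQuadraticUnit (2 * d) x) := by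
  obtain ⟨hmem, hi, hi'⟩ := mem_unitGroupIn_iff.1 hu
  obtain ⟨T, N, hTN⟩ := exists_sq_eq_of_finrank_eq_two hk2 hmem
  -- Here w² = T² - 4N is rational, so w is real or purely imaginary. A real w is a rational
  -- multiple of 1, √2, √d or √(2d), which places u in a real quadratic field.
  obtain ⟨w, hw⟩ : ∃ w : ℂ, w = 2 * u - T := ⟨_, rfl⟩
  have huw : 2 * (u : ℂ) = T + w := by rw [hw]; ring
  have hw2 : w ^ 2 = ((T ^ 2 - 4 * N : ℚ) : ℂ) := by
    rw [hw]
    push_cast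
    linear_combination 4 * hTN
  have hwmem : w ∈ fieldL d := by
    rw [hw]
    exact sub_mem (mul_mem (ofNat_mem _ 2) (hk hmem)) (SubfieldClass.ratCast_mem _ _)
  have hre := congrArg Complex.re hw2
  have him := congrArg Complex.im hw2
  rw [sq, Complex.mul_re, Complex.ratCast_re] at hre
  rw [sq, Complex.mul_im, Complex.ratCast_im] at him
  have hprod : w.re * w.im = 0 := by linarith
  have hwri := Complex.re_add_im w
  by_cases hwim : w.im = 0
  · right
    rw [hwim] at hre hwri
    have hwre : w = (w.re : ℂ) := by simpa using hwri.symm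
    have hreal : (u : ℂ) = (((T + w.re) / 2 : ℝ) : ℂ) := by
      push_cast
      rw [← hwre]
      linear_combination huw / 2
    refine ⟨_, hreal, ?_⟩
    rw [hreal, ← Complex.ofReal_inv] at hi'
    rw [hreal] at hi
    rw [isIntegral_ofReal_iff] at hi hi'
    have hx0 : (T + w.re) / 2 ≠ 0 := by
      intro h
      rw [h] at hreal
      simp at hreal
    obtain ⟨a, ha⟩ := eq_or_of_sq_eq_ratCast D.not_isSquare D.not_isSquare_two_mul
      (mem_fieldL_iff.1 hwmem).1 (n := T ^ 2 - 4 * N) (by rw [← hre]; ring)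
    rcases ha with ha | ha | ha | ha
    · exact Or.inl ⟨hx0, hi, hi', (T + a) / 2, 0, by rw [ha]; push_cast; ring⟩
    · exact Or.inl ⟨hx0, hi, hi', T / 2, a / 2, by rw [ha]; push_cast; ring⟩
    · exact Or.inr (Or.inl ⟨hx0, hi, hi', T / 2, a / 2, by rw [ha]; push_cast; ring⟩)
    · exact Or.inr (Or.inr ⟨hx0, hi, hi', T / 2, a / 2, by rw [ha]; push_cast; ring⟩)
  · left
    have hwre : w.re = 0 := by simpa [hwim] using hprod
    rw [hwre] at hre hwri
    have hwI : w = w.im * Complex.I := by simpa using hwri.symm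
    rw [hwI] at huw
    -- In the imaginary case N = uū and T = u + ū are rational integers, and N, being a positive
    -- unit, is 1.
    have hnorm : Complex.normSq u = (N : ℝ) := by
      have h4 : Complex.normSq (2 * (u : ℂ)) = T ^ 2 + w.im ^ 2 := by
        rw [huw, Complex.normSq_apply]
        simp
        ring
      rw [map_mul, show (2 : ℂ) = ((2 : ℝ) : ℂ) by simp, Complex.normSq_ofReal] at h4
      push_cast at hre
      linarith
    have hconj : (u : ℂ) + (starRingEnd ℂ) u = ((T : ℝ) : ℂ) := by
      have h2 : (starRingEnd ℂ) 2 = 2 := map_ofNat _ 2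
      have := congrArg (starRingEnd ℂ) huw
      simp [h2] at this
      push_cast
      linear_combination huw / 2 + this / 2
    have hTint : IsIntegral ℤ (T : ℝ) := by
      rw [← isIntegral_ofReal_iff, ← hconj]
      exact hi.add (isIntegral_conj hi)
    have hNint : IsIntegral ℤ (N : ℝ) := by
      rw [← isIntegral_ofReal_iff, ← hnorm, ← Complex.mul_conj]
      exact hi.mul (isIntegral_conj hi)
    have hNint' : IsIntegral ℤ ((N⁻¹ : ℚ) : ℝ) := by
      rw [← isIntegral_ofReal_iff, Rat.cast_inv, ← hnorm, Complex.ofReal_inv, ← Complex.mul_conj,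
        mul_inv, ← map_inv₀]
      exact hi'.mul (isIntegral_conj hi')
    have hNpos : 0 < N := by
      have : (0 : ℝ) < N := by rw [← hnorm, Complex.normSq_pos]; exact u.ne_zero
      exact_mod_cast this
    have hN1 : N = 1 := by
      rcases rat_eq_one_or_neg_one hNint hNint' (mul_inv_cancel₀ hNpos.ne') with h | h
      · exact h
      · linarith
    obtain ⟨T, rfl⟩ := exists_int_of_isIntegral hTint
    have h12 : (u : ℂ) ^ 12 = 1 := by
      apply pow_twelve_eq_one_of_imaginary hwim (T := T) (by rw [huw]; push_cast; rfl)
      rw [hN1] at hre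
      push_cast at hre
      linarith
    -- Orders 3 and 6 are excluded because L_d has only eighth roots of unity; u¹² = u⁸ = 1 gives u⁴
    -- = 1.
    have h8 := D.pow_eight_eq_one (hk hmem) (by norm_num) h12
    have h4 : (u : ℂ) ^ 4 = 1 := by
      have e : (u : ℂ) ^ 12 = (u : ℂ) ^ 8 * (u : ℂ) ^ 4 := by ring
      rw [h12, h8, one_mul] at e
      exact e.symm
    obtain ⟨j, -, hj⟩ := Complex.isPrimitiveRoot_I.eq_pow_of_pow_eq_one h4
    exact ⟨j, hj.symm⟩

/-- Imaginary non-real units are powers of i and real ones are ± powers of ε₂, ε_d or ε_{2d}.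
Conversely ℚ(i), ℚ(√2), ℚ(√d) and ℚ(√(2d)) supply the generators. -/
theorem quadraticUnits_eq_closure (D : BiquadraticUnitData d) (hζ : (ζ : ℂ) = zetaEight)
    (h₂ : (e₂ : ℂ) = fundamentalUnit 2) (h_d : (e_d : ℂ) = fundamentalUnit d)
    (hs : (s : ℂ) = √(fundamentalUnit (2 * d))) :
    quadraticUnits (fieldL d) = Subgroup.closure {ζ ^ 2, e₂, e_d, s ^ 2} := by
  have hζ2 : ((ζ ^ 2 : ℂˣ) : ℂ) = Complex.I := by
    push_cast; rw [hζ, zetaEight_sq]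
  have hs2 : ((s ^ 2 : ℂˣ) : ℂ) = fundamentalUnit (2 * d) := by
    push_cast
    rw [hs, ← Complex.ofReal_pow, Real.sq_sqrt D.fundamentalUnit_two_mul_pos.le]
  apply le_antisymm
  · refine iSup₂_le fun k hk u hu => ?_
    have gζ : ζ ^ 2 ∈ Subgroup.closure {ζ ^ 2, e₂, e_d, s ^ 2} := Subgroup.subset_closure (by simp)
    have g2 : e₂ ∈ Subgroup.closure {ζ ^ 2, e₂, e_d, s ^ 2} := Subgroup.subset_closure (by simp)
    have gd : e_d ∈ Subgroup.closure {ζ ^ 2, e₂, e_d, s ^ 2} := Subgroup.subset_closure (by simp)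
    have gs : s ^ 2 ∈ Subgroup.closure {ζ ^ 2, e₂, e_d, s ^ 2} := Subgroup.subset_closure (by simp)
    have key {m : ℕ} (hm : ¬ IsSquare m) {x : ℝ} (hx : IsQuadraticUnit m x) (hux : (u : ℂ) = x)
        {e : ℂˣ} (he : (e : ℂ) = fundamentalUnit m)
        (hmem : e ∈ Subgroup.closure {ζ ^ 2, e₂, e_d, s ^ 2}) :
        u ∈ Subgroup.closure {ζ ^ 2, e₂, e_d, s ^ 2} := by
      obtain ⟨n, hn | hn⟩ := hx.exists_zpow hm
      · have : u = e ^ n := by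
          apply Units.ext
          rw [Units.val_zpow_eq_zpow_val, he, hux, hn]
          push_cast
          rfl
        rw [this]
        exact zpow_mem hmem n
      · have : u = (ζ ^ 2) ^ 2 * e ^ n := by
          apply Units.ext
          rw [Units.val_mul, Units.val_pow_eq_pow_val, hζ2, Units.val_zpow_eq_zpow_val, he, hux, hn]
          push_cast
          rw [Complex.I_sq]
          ring
        rw [this]
        exact mul_mem (pow_mem gζ 2) (zpow_mem hmem n)
    rcases D.eq_pow_I_or_isQuadraticUnit hk.1 hk.2 hu with ⟨j, hj⟩ | ⟨x, hux, hx | hx | hx⟩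
    · have : u = (ζ ^ 2) ^ j := by
        apply Units.ext
        rw [Units.val_pow_eq_pow_val, hζ2, hj]
      rw [this]
      exact pow_mem gζ j
    · exact key not_isSquare_two hx hux h₂ g2
    · exact key D.not_isSquare hx hux h_d gd
    · exact key D.not_isSquare_two_mul hx hux hs2 gs
  · have hle {m : ℕ} (h : √(m : ℝ) ∈ realBiquadratic d) : quadraticFieldIn m ≤ fieldL d := by
      intro z hz
      obtain ⟨a, b, rfl⟩ := mem_quadraticFieldIn_iff.1 hz
      rw [ofReal_mem_fieldL_iff]
      exact add_mem (ratCast_mem_realBiquadratic d a) (mul_mem (ratCast_mem_realBiquadratic d b) h)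
    have key {m : ℕ} (hm : ¬ IsSquare m) (h : √(m : ℝ) ∈ realBiquadratic d) {e : ℂˣ}
        (he : (e : ℂ) = fundamentalUnit m) : e ∈ quadraticUnits (fieldL d) := by
      have : unitGroupIn (quadraticFieldIn m) ≤ quadraticUnits (fieldL d) :=
        le_iSup₂_of_le (quadraticFieldIn m) ⟨hle h, finrank_quadraticFieldIn hm⟩ le_rfl
      exact this ((ofReal_mem_unitGroupIn_quadraticFieldIn he).2
        (isQuadraticUnit_fundamentalUnit hm))
    rw [Subgroup.closure_le]
    rintro w (rfl | rfl | rfl | rfl)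
    · have : unitGroupIn ℚ⟮Complex.I⟯ ≤ quadraticUnits (fieldL d) := by
        refine le_iSup₂_of_le ℚ⟮Complex.I⟯ ⟨?_, ?_⟩ le_rfl
        · rw [adjoin_simple_le_iff]
          exact I_mem_fieldL
        · exact finrank_adjoin_of_sq_eq (q := -1) (by simp)
            (fun b hb => by nlinarith [sq_nonneg b])
      apply this
      have hI : IsIntegral ℤ Complex.I := Complex.isPrimitiveRoot_I.isIntegral (by norm_num)
      rw [mem_unitGroupIn_iff, hζ2]
      exact ⟨mem_adjoin_simple_self ℚ _, hI, by rw [Complex.inv_I]; exact hI.neg⟩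
    · exact key not_isSquare_two (by simpa using sqrt_two_mem_realBiquadratic d) h₂
    · exact key D.not_isSquare (sqrt_mem_realBiquadratic d) h_d
    · refine key D.not_isSquare_two_mul ?_ hs2
      rw [sqrt_two_mul_eq]
      exact mul_mem (sqrt_two_mem_realBiquadratic d) (sqrt_mem_realBiquadratic d)

theorem unitIndex_eq_four (D : BiquadraticUnitData d) (hζ : (ζ : ℂ) = zetaEight)
    (h₂ : (e₂ : ℂ) = fundamentalUnit 2) (h_d : (e_d : ℂ) = fundamentalUnit d)
    (hs : (s : ℂ) = √(fundamentalUnit (2 * d))) : unitIndex (fieldL d) = 4 := by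
  have hζ2 : ((ζ ^ 2 : ℂˣ) : ℂ) = Complex.I := by
    push_cast; rw [hζ, zetaEight_sq]
  have hs2 : ((s ^ 2 : ℂˣ) : ℂ) = fundamentalUnit (2 * d) := by
    push_cast
    rw [hs, ← Complex.ofReal_pow, Real.sq_sqrt D.fundamentalUnit_two_mul_pos.le]
  have p2 := fundamentalUnit_two_pos
  have pd := D.fundamentalUnit_pos
  have p2d := D.fundamentalUnit_two_mul_pos
  have ps := D.sqrt_fundamentalUnit_pos
  have hsH : s ∉ Subgroup.closure {ζ ^ 2, e₂, e_d, s ^ 2} := by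
    intro hmem
    -- Absolute values discard the powers of i, reducing to `sqrt_fundamentalUnit_ne`.
    have key (w : ℂˣ) (hw : w ∈ Subgroup.closure {ζ ^ 2, e₂, e_d, s ^ 2}) : ∃ a b c : ℤ,
        ‖(w : ℂ)‖ = fundamentalUnit 2 ^ a * fundamentalUnit d ^ b * fundamentalUnit (2 * d) ^ c := by
      induction hw using Subgroup.closure_induction with
      | mem x hx =>
        rcases hx with rfl | rfl | rfl | rfl
        · exact ⟨0, 0, 0, by rw [hζ2]; simp⟩
        · exact ⟨1, 0, 0, by rw [h₂]; simp [p2.le]⟩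
        · exact ⟨0, 1, 0, by rw [h_d]; simp [pd.le]⟩
        · exact ⟨0, 0, 1, by rw [hs2]; simp [p2d.le]⟩
      | one => exact ⟨0, 0, 0, by simp⟩
      | mul x y _ _ hx hy =>
        obtain ⟨a, b, c, h⟩ := hx
        obtain ⟨a', b', c', h'⟩ := hy
        refine ⟨a + a', b + b', c + c', ?_⟩
        rw [Units.val_mul, norm_mul, h, h', zpow_add₀ p2.ne', zpow_add₀ pd.ne', zpow_add₀ p2d.ne']
        ring
      | inv x _ hx =>
        obtain ⟨a, b, c, h⟩ := hx
        refine ⟨-a, -b, -c, ?_⟩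
        rw [Units.val_inv_eq_inv_val, norm_inv, h, zpow_neg, zpow_neg, zpow_neg, mul_inv, mul_inv]
    obtain ⟨a, b, c, h⟩ := key s hmem
    rw [hs, Complex.norm_real, Real.norm_of_nonneg ps.le] at h
    exact D.sqrt_fundamentalUnit_ne a b c h
  have hζH : ζ ∉ Subgroup.closure {s, ζ ^ 2, e₂, e_d, s ^ 2} := by
    intro hmem
    -- All generators have real squares, whereas ζ₈² = i.
    have key (w : ℂˣ) (hw : w ∈ Subgroup.closure {s, ζ ^ 2, e₂, e_d, s ^ 2}) :
        ∃ r : ℝ, (w : ℂ) ^ 2 = r := by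
      induction hw using Subgroup.closure_induction with
      | mem x hx =>
        rcases hx with rfl | rfl | rfl | rfl | rfl
        · exact ⟨_, by rw [hs]; exact (Complex.ofReal_pow _ 2).symm⟩
        · exact ⟨-1, by rw [hζ2]; simp⟩
        · exact ⟨_, by rw [h₂]; exact (Complex.ofReal_pow _ 2).symm⟩
        · exact ⟨_, by rw [h_d]; exact (Complex.ofReal_pow _ 2).symm⟩
        · exact ⟨_, by rw [hs2]; exact (Complex.ofReal_pow _ 2).symm⟩
      | one => exact ⟨1, by simp⟩
      | mul x y _ _ hx hy =>
        obtain ⟨r, h⟩ := hx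
        obtain ⟨r', h'⟩ := hy
        exact ⟨r * r', by rw [Units.val_mul, mul_pow, h, h', Complex.ofReal_mul]⟩
      | inv x _ hx =>
        obtain ⟨r, h⟩ := hx
        exact ⟨r⁻¹, by rw [Units.val_inv_eq_inv_val, inv_pow, h, Complex.ofReal_inv]⟩
    obtain ⟨r, h⟩ := key ζ hmem
    rw [hζ, zetaEight_sq] at h
    simpa using congrArg Complex.im h
  -- Keeping the redundant ζ² and s² presents E_L as two successive insertions of one generator,
  -- each of index 2.
  have hset : unitGroupIn (fieldL d) =
      Subgroup.closure {ζ, s, ζ ^ 2, e₂, e_d, s ^ 2} := by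
    rw [D.unitGroupIn_eq_closure hζ h₂ h_d hs]
    apply le_antisymm
    · apply Subgroup.closure_mono
      rintro w (rfl | rfl | rfl | rfl) <;> simp
    · rw [Subgroup.closure_le]
      rintro w (rfl | rfl | rfl | rfl | rfl | rfl)
      · exact Subgroup.subset_closure (by simp)
      · exact Subgroup.subset_closure (by simp)
      · exact pow_mem (Subgroup.subset_closure (by simp)) 2
      · exact Subgroup.subset_closure (by simp)
      · exact Subgroup.subset_closure (by simp)
      · exact pow_mem (Subgroup.subset_closure (by simp)) 2
  rw [unitIndex, D.quadraticUnits_eq_closure hζ h₂ h_d hs, hset,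
    ← Subgroup.relIndex_mul_relIndex _ (Subgroup.closure {s, ζ ^ 2, e₂, e_d, s ^ 2}) _
      (Subgroup.closure_mono (Set.subset_insert _ _))
      (Subgroup.closure_mono (Set.subset_insert _ _)),
    Subgroup.relIndex_closure_insert_eq_two _ hsH (Subgroup.subset_closure (by simp)),
    Subgroup.relIndex_closure_insert_eq_two _ hζH (Subgroup.subset_closure (by simp))]

end generators

end BiquadraticUnitData

theorem mainTheorem5 (q₁ q₂ : ℕ) [Fact q₁.Prime] [Fact q₂.Prime]
    (hq₁ : q₁ % 8 = 3) (hq₂ : q₂ % 8 = 3) (hq : legendreSym q₂ (q₁ : ℤ) = 1) :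
    (∃ ζ e₂ e_d s_2d : ℂˣ,
      (ζ : ℂ) = zetaEight ∧
      (e₂ : ℂ) = (fundamentalUnit 2 : ℝ) ∧
      (e_d : ℂ) = (fundamentalUnit (q₁ * q₂) : ℝ) ∧
      (s_2d : ℂ) = (Real.sqrt (fundamentalUnit (2 * q₁ * q₂)) : ℝ) ∧
      unitGroupIn (fieldL (q₁ * q₂)) = Subgroup.closure {ζ, e₂, e_d, s_2d}) ∧
    unitIndex (fieldL (q₁ * q₂)) = 4 := by
  have hne : q₁ ≠ q₂ := by
    rintro rfl
    have : legendreSym q₁ (q₁ : ℤ) = 0 := (legendreSym.eq_zero_iff q₁ _).2 (by simp)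
    rw [this] at hq
    exact zero_ne_one hq
  have D := biquadraticUnitData_mul Fact.out Fact.out hne hq₁ hq₂
  rw [mul_assoc]
  have hζ : ((Units.mk0 zetaEight zetaEight_ne_zero : ℂˣ) : ℂ) = zetaEight := rfl
  have h₂ := Units.val_mk0 (a := ((fundamentalUnit 2 : ℝ) : ℂ))
    (Complex.ofReal_ne_zero.2 BiquadraticUnitData.fundamentalUnit_two_pos.ne')
  have h_d := Units.val_mk0 (a := ((fundamentalUnit (q₁ * q₂) : ℝ) : ℂ))
    (Complex.ofReal_ne_zero.2 D.fundamentalUnit_pos.ne')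
  have hs := Units.val_mk0 (a := ((√(fundamentalUnit (2 * (q₁ * q₂))) : ℝ) : ℂ))
    (Complex.ofReal_ne_zero.2 D.sqrt_fundamentalUnit_pos.ne')
  exact ⟨⟨_, _, _, _, hζ, h₂, h_d, hs, D.unitGroupIn_eq_closure hζ h₂ h_d hs⟩,
    D.unitIndex_eq_four hζ h₂ h_d hs⟩
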